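/- Let $S=\mathbb{C}[x,y,z]$ with its standard grading, let $d\ge 4$, and let $C: f=0$ be a reduced plane curve of degree $d$ in $\mathbb{P}^2$, i.e. $f\in S$ is homogeneous of degree $d$ and square-free. Write $J_f=(f_x,f_y,f_z)$ for the ideal generated by the partial derivatives of $f$, $M(f)=S/J_f$ for the Milnor algebra, and $AR(f)=\{(a,b,c)\in S^3 : af_x+bf_y+cf_z=0\}$, where $(a,b,c)$ has degree $r$ if $a,b,c\in S_r$. Let $\mathrm{reg}(f)$ be the Castelnuovo–Mumford regularity of the graded $S$-module $M(f)$, that is, the maximum of $a-i$ over all $i \geq 0$ and all summands $S(-a)$ of the $i$-th module of a minimal graded free resolution of $M(f)$. Let $mdr_e(f)$ be the minimal degree of a homogeneous element of $AR(f)$ that does not lie in the $S$-submodule generated by the Koszul relations $(f_y,-f_x,0)$, $(f_z,0,-f_x)$, $(0,f_z,-f_y)$, with $mdr_e(f)=+\infty$ if there is no such element (which happens only when $C$ is smooth). The curve $C$ is called free if there is an isomorphism of graded $S$-modules $AR(f)\cong S(-d_1)\oplus S(-d_2)$ for some integers $d_1,d_2\ge 0$. It is called nearly free if, for some integers $1\le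 d_1\le d_2$, $M(f)$ has a minimal graded free resolution of the form $$0\to S(-d-d_2)\to S(-d-d_1+1)\oplus S(-d-d_2+1)^2\to S(-d+1)^3\xrightarrow{(f_x,f_y,f_z)} S.$$ Then the following hold. 1. $C$ is free if and only if $\mathrm{reg}(f)=2(d-2)-mdr_e(f)$. 2. $C$ is nearly free if and only if $\mathrm{reg}(f)=2(d-2)-mdr_e(f)+1$. 3. If $C$ is neither free nor nearly free, then $\mathrm{reg}(f)\ge 2(d-2)-mdr_e(f)+2$. (If $mdr_e(f)=+\infty$, the right-hand sides are read as $-\infty$.) -/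

import Mathlib

namespace PlaneCurve

open MvPolynomial

/-- The graded polynomial ring `S = ℂ[x, y, z]`, with `x = X 0`, `y = X 1`, `z = X 2`. -/
abbrev PolyRing : Type := MvPolynomial (Fin 3) ℂ

/-- The graded piece `S_k` of `S`, for an integer `k` (it is zero when `k < 0`). -/
noncomputable def gradedPiece (k : ℤ) : Submodule ℂ PolyRing :=
  if 0 ≤ k then homogeneousSubmodule (Fin 3) ℂ k.toNat else ⊥

/-- The degree `k` piece of the graded free module `⨁ j, S(-a j)`, whose `j`-th basis vector
has degree `a j`. -/
noncomputable def freePiece {n : ℕ} (a : Fin n → ℤ) (k : ℤ) : Submodule ℂ (Fin n → PolyRing) :=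
  Submodule.pi Set.univ fun j => gradedPiece (k - a j)

/-- The `S`-linear map `φ` is homogeneous of degree `0` as a map
`⨁ j, S(-a j) → ⨁ i, S(-b i)`. -/
def IsGradedMap {m n : ℕ} (a : Fin m → ℤ) (b : Fin n → ℤ)
    (φ : (Fin m → PolyRing) →ₗ[PolyRing] (Fin n → PolyRing)) : Prop :=
  ∀ k : ℤ, ∀ v ∈ freePiece a k, φ v ∈ freePiece b k

/-- The image of `φ` is contained in `(x, y, z)` times the target. -/
def IsMinimalMap {m n : ℕ} (φ : (Fin m → PolyRing) →ₗ[PolyRing] (Fin n → PolyRing)) : Prop :=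
  ∀ v i, constantCoeff (φ v i) = 0

/-- A minimal graded free resolution
`⋯ → F₂ → F₁ → F₀ → M → 0`, with `F i = ⨁ j, S(-shift i j)` of finite rank `rank i`, of an
`S`-module `M` graded by the subspaces `ℳ k`. -/
structure MinimalGradedFreeResolution {M : Type*} [AddCommGroup M] [Module PolyRing M]
    [Module ℂ M] (ℳ : ℤ → Submodule ℂ M) where
  rank : ℕ → ℕ
  shift : (i : ℕ) → Fin (rank i) → ℤ
  diff : (i : ℕ) → (Fin (rank (i + 1)) → PolyRing) →ₗ[PolyRing] (Fin (rank i) → PolyRing)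
  aug : (Fin (rank 0) → PolyRing) →ₗ[PolyRing] M
  diff_graded : ∀ i, IsGradedMap (shift (i + 1)) (shift i) (diff i)
  aug_graded : ∀ k : ℤ, ∀ v ∈ freePiece (shift 0) k, aug v ∈ ℳ k
  aug_surjective : Function.Surjective aug
  exact_zero : Function.Exact (diff 0) aug
  exact_succ : ∀ i, Function.Exact (diff (i + 1)) (diff i)
  minimal : ∀ i, IsMinimalMap (diff i)

/-- The Castelnuovo–Mumford regularity of a graded `S`-module: the supremum of `a - i` over
all summands `S(-a)` of the `i`-th module of a minimal graded free resolution. (Minimal graded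
free resolutions are unique up to isomorphism, so it does not matter that all of them are
ranged over. The value is an extended real, so that the supremum is always meaningful.) -/
noncomputable def regularity {M : Type*} [AddCommGroup M] [Module PolyRing M]
    [Module ℂ M] (ℳ : ℤ → Submodule ℂ M) : EReal :=
  ⨆ (F : MinimalGradedFreeResolution ℳ) (i : ℕ) (j : Fin (F.rank i)),
    (((F.shift i j - (i : ℤ) : ℤ) : ℝ) : EReal)

/-- The Jacobian ideal `J_f = (f_x, f_y, f_z)`. -/
noncomputable def jacobianIdeal (f : PolyRing) : Ideal PolyRing :=
  Ideal.span (Set.range fun i : Fin 3 => pderiv i f)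

/-- The Milnor (or Jacobian) algebra `M(f) = S / J_f`. -/
abbrev MilnorAlgebra (f : PolyRing) : Type := PolyRing ⧸ jacobianIdeal f

/-- The graded piece `M(f)_k`: the image of `S_k` in `S / J_f`. -/
noncomputable def milnorPiece (f : PolyRing) (k : ℤ) : Submodule ℂ (MilnorAlgebra f) :=
  (gradedPiece k).map (Ideal.Quotient.mkₐ ℂ (jacobianIdeal f)).toLinearMap

/-- `reg(f)`, the Castelnuovo–Mumford regularity of `M(f)` as a graded `S`-module. -/
noncomputable def reg (f : PolyRing) : EReal := regularity (milnorPiece f)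

/-- The map `S³ → S`, `(a, b, c) ↦ a f_x + b f_y + c f_z`. -/
noncomputable def jacobianMap (f : PolyRing) : (Fin 3 → PolyRing) →ₗ[PolyRing] PolyRing :=
  Fintype.linearCombination PolyRing fun i : Fin 3 => pderiv i f

/-- The module `AR(f)` of Jacobian relations `a f_x + b f_y + c f_z = 0`. -/
noncomputable def AR (f : PolyRing) : Submodule PolyRing (Fin 3 → PolyRing) :=
  LinearMap.ker (jacobianMap f)

/-- The submodule of `AR(f)` generated by the Koszul relations. -/
noncomputable def koszulRelations (f : PolyRing) : Submodule PolyRing (Fin 3 → PolyRing) :=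
  Submodule.span PolyRing
    {![pderiv 1 f, -pderiv 0 f, 0], ![pderiv 2 f, 0, -pderiv 0 f], ![0, pderiv 2 f, -pderiv 1 f]}

/-- `mdr_e(f)`: the minimal `r` such that there is a relation in `AR(f)` with coefficients in
`S_r` that is not in the submodule of Koszul relations (`⊤` if there is none, which happens for
smooth curves only). -/
noncomputable def mdre (f : PolyRing) : ℕ∞ :=
  ⨅ (r : ℕ) (_ : ∃ v ∈ AR f, (∀ i, (v i).IsHomogeneous r) ∧ v ∉ koszulRelations f), (r : ℕ∞)

/-- `f = 0` is free: `AR(f) ≅ S(-d₁) ⊕ S(-d₂)` as graded modules, i.e. `AR(f)` has a basis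
of two elements that are homogeneous of degrees `d₁` and `d₂`. -/
def IsFreeCurve (f : PolyRing) : Prop :=
  ∃ (e : Fin 2 → ℕ) (b : Module.Basis (Fin 2) PolyRing (AR f)),
    ∀ j i, ((b j : Fin 3 → PolyRing) i).IsHomogeneous (e j)

/-- `f = 0`, of degree `d`, is nearly free: for some `1 ≤ d₁ ≤ d₂`, the module `M(f)` has a minimal
graded free resolution
`0 → S(-d-d₂) → S(-d-d₁+1) ⊕ S(-d-d₂+1)² → S(-d+1)³ → S` in which the last map is
`(f_x, f_y, f_z)`. -/
def IsNearlyFreeCurve (f : PolyRing) (d : ℕ) : Prop :=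
  ∃ (d₁ d₂ : ℕ) (ψ : (Fin 1 → PolyRing) →ₗ[PolyRing] (Fin 3 → PolyRing))
    (φ : (Fin 3 → PolyRing) →ₗ[PolyRing] (Fin 3 → PolyRing)),
    1 ≤ d₁ ∧ d₁ ≤ d₂ ∧
    IsGradedMap ![(d + d₂ : ℤ)] ![(d + d₁ - 1 : ℤ), (d + d₂ - 1 : ℤ), (d + d₂ - 1 : ℤ)] ψ ∧
    IsGradedMap ![(d + d₁ - 1 : ℤ), (d + d₂ - 1 : ℤ), (d + d₂ - 1 : ℤ)]
      ![(d - 1 : ℤ), (d - 1 : ℤ), (d - 1 : ℤ)] φ ∧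
    IsMinimalMap ψ ∧ IsMinimalMap φ ∧ (∀ v, constantCoeff (jacobianMap f v) = 0) ∧
    Function.Injective ψ ∧ Function.Exact ψ φ ∧ Function.Exact φ (jacobianMap f)

end PlaneCurve

/-!
Write `∇f = (f_x, f_y, f_z)`. As `f` is square-free, Euler's identity shows that the entries of `∇f`
have no common factor (`isPrimitiveVector_grad`). Two Jacobian relations `u`, `v` are orthogonal
to `∇f`, so `u × v = h ∇f` for a polynomial `h`, the multiplier of the pair. Let `u ≠ 0` be a
relation of the least degree `r`. It is primitive, so `v` is a multiple of `u` when the multiplier of `u` and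
`v` is zero, and `AR(f) / S u` is, up to a shift, the ideal of all multipliers of `u`.

* If this ideal is `S`, then `u` and some `v` form a basis, and the curve is free. Then the degrees
  of the basis are `r` and `d - 1 - r`, and an explicit resolution of `M(f)` gives
  `reg(f) = 2 (d - 2) - r` (`reg_eq_of_isFreeCurve`).
* If the curve is nearly free, a Hilbert-Burch argument gives `d₁ = r`, `d₁ + d₂ = d`, and hence
  `reg(f) = 2 (d - 2) - r + 1` (`reg_eq_of_isNearlyFreeCurve`).
* If `AR(f)` is generated in degrees at most `d - r`, then the ideal is `S` or is generated by
  linear forms. It is not `(x, y, z)`, by exactness of the Koszul complex of `x, y, z`; if it is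
  generated by two independent linear forms, the curve is nearly free, and otherwise it is free
  (`isFreeCurve_or_isNearlyFreeCurve`). So for all other curves a generator of degree at least
  `d - r + 1` is needed, and it contributes at least `2 (d - 2) - r + 2` to the regularity
  (`le_reg_of_not_generated`).

Finally `r ≤ mdr_e(f)` always, and equality holds when `r < d - 1`, since the Koszul relations
start in degree `d - 1` (`mdre_eq`); this covers the free and the nearly free curves.

The regularity is a supremum over all minimal resolutions. Existence of minimal resolutions with a
given beginning is `exists_resolution_extending`; that a single one computes the regularity is
`regularity_eq_of_resolution`, which rests on the comparison theorem for resolutions.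
-/

namespace PlaneCurve

open MvPolynomial
open scoped Matrix

/-! ### Graded pieces and homogeneous components -/

theorem mem_gradedPiece_natCast {n : ℕ} {p : PolyRing} :
    p ∈ gradedPiece (n : ℤ) ↔ p.IsHomogeneous n := by
  simp [gradedPiece]

theorem eq_zero_of_mem_gradedPiece_neg {k : ℤ} (hk : k < 0) {p : PolyRing}
    (hp : p ∈ gradedPiece k) : p = 0 := by
  simpa [gradedPiece, not_le.2 hk] using hp

/-- A nonzero homogeneous polynomial has a nonnegative degree. -/
theorem exists_nat_of_mem_gradedPiece {k : ℤ} {p : PolyRing} (hp : p ∈ gradedPiece k)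
    (h0 : p ≠ 0) : ∃ n : ℕ, k = n ∧ p.IsHomogeneous n := by
  rcases lt_or_ge k 0 with hk | hk
  · exact absurd (eq_zero_of_mem_gradedPiece_neg hk hp) h0
  · lift k to ℕ using hk
    exact ⟨k, rfl, mem_gradedPiece_natCast.1 hp⟩

theorem mul_mem_gradedPiece {k l : ℤ} {p q : PolyRing} (hp : p ∈ gradedPiece k)
    (hq : q ∈ gradedPiece l) : p * q ∈ gradedPiece (k + l) := by
  by_cases hp0 : p = 0
  · simp [hp0]
  by_cases hq0 : q = 0
  · simp [hq0]
  obtain ⟨m, rfl, hm⟩ := exists_nat_of_mem_gradedPiece hp hp0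
  obtain ⟨n, rfl, hn⟩ := exists_nat_of_mem_gradedPiece hq hq0
  exact_mod_cast mem_gradedPiece_natCast.2 (hm.mul hn)

theorem constantCoeff_eq_zero_of_mem_gradedPiece {k : ℤ} (hk : k ≠ 0) {p : PolyRing}
    (hp : p ∈ gradedPiece k) : constantCoeff p = 0 := by
  by_cases hp0 : p = 0
  · simp [hp0]
  obtain ⟨m, rfl, hm⟩ := exists_nat_of_mem_gradedPiece hp hp0
  rw [constantCoeff_eq]
  exact hm.coeff_eq_zero (by simpa [Finsupp.degree] using fun h : 0 = m => hk (by simp [← h]))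

/-- The homogeneous component of degree `k` of a polynomial, for an integer `k`. -/
noncomputable def component (k : ℤ) : PolyRing →ₗ[ℂ] PolyRing :=
  if 0 ≤ k then homogeneousComponent k.toNat else 0

theorem component_mem (k : ℤ) (p : PolyRing) : component k p ∈ gradedPiece k := by
  unfold component gradedPiece
  split_ifs
  · exact homogeneousComponent_mem _ _
  · simp

theorem component_of_mem {k : ℤ} {p : PolyRing} (hp : p ∈ gradedPiece k) : component k p = p := by
  by_cases hp0 : p = 0
  · simp [hp0]
  obtain ⟨m, rfl, hm⟩ := exists_nat_of_mem_gradedPiece hp hp0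
  simp [component, homogeneousComponent_of_mem hm]

theorem component_of_mem_ne {j k : ℤ} (hjk : j ≠ k) {p : PolyRing} (hp : p ∈ gradedPiece j) :
    component k p = 0 := by
  by_cases hp0 : p = 0
  · simp [hp0]
  obtain ⟨m, rfl, hm⟩ := exists_nat_of_mem_gradedPiece hp hp0
  unfold component
  split_ifs with hk
  · lift k to ℕ using hk
    rw [homogeneousComponent_of_mem hm, if_neg]
    simpa using fun h => hjk (by simpa using h.symm)
  · simp

theorem mem_freePiece {n : ℕ} {a : Fin n → ℤ} {k : ℤ} {v : Fin n → PolyRing} :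
    v ∈ freePiece a k ↔ ∀ j, v j ∈ gradedPiece (k - a j) := by
  simp [freePiece, Submodule.mem_pi]

/-- Graded free modules are spanned by their graded pieces. -/
theorem freePiece_induction {n : ℕ} (a : Fin n → ℤ) {motive : (Fin n → PolyRing) → Prop}
    (piece : ∀ k, ∀ v ∈ freePiece a k, motive v)
    (add : ∀ v w, motive v → motive w → motive (v + w)) (v : Fin n → PolyRing) : motive v := by
  have zero : motive 0 := piece 0 0 (zero_mem _)
  rw [← Finset.univ_sum_single v]
  refine Finset.sum_induction _ motive add zero fun j _ => ?_
  rw [← sum_homogeneousComponent (v j), ← LinearMap.coe_single ℂ (fun _ => PolyRing) j, map_sum]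
  refine Finset.sum_induction _ motive add zero fun m _ => ?_
  refine piece (m + a j) _ (mem_freePiece.2 fun i => ?_)
  rcases eq_or_ne i j with rfl | hij
  · simpa using mem_gradedPiece_natCast.2 (homogeneousComponent_mem m (v i))
  · simp [hij]

/-- The homogeneous component of degree `k` of an element of `⨁ j, S(-a j)`. -/
noncomputable def freeComponent {n : ℕ} (a : Fin n → ℤ) (k : ℤ) :
    (Fin n → PolyRing) →ₗ[ℂ] (Fin n → PolyRing) :=
  LinearMap.pi fun j => component (k - a j) ∘ₗ LinearMap.proj j

theorem freeComponent_mem {n : ℕ} (a : Fin n → ℤ) (k : ℤ) (v : Fin n → PolyRing) :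
    freeComponent a k v ∈ freePiece a k :=
  mem_freePiece.2 fun _ => component_mem _ _

theorem freeComponent_of_mem {n : ℕ} {a : Fin n → ℤ} {k : ℤ} {v : Fin n → PolyRing}
    (hv : v ∈ freePiece a k) : freeComponent a k v = v :=
  funext fun j => component_of_mem (mem_freePiece.1 hv j)

theorem freeComponent_of_mem_ne {n : ℕ} {a : Fin n → ℤ} {j k : ℤ} (hjk : j ≠ k)
    {v : Fin n → PolyRing} (hv : v ∈ freePiece a j) : freeComponent a k v = 0 :=
  funext fun i => component_of_mem_ne (by simpa using hjk) (mem_freePiece.1 hv i)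

theorem eq_zero_of_freeComponent_eq_zero {n : ℕ} (a : Fin n → ℤ) {v : Fin n → PolyRing}
    (hv : ∀ k, freeComponent a k v = 0) : v = 0 := by
  funext j
  rw [← sum_homogeneousComponent (v j)]
  refine Finset.sum_eq_zero fun m _ => ?_
  simpa [freeComponent, component] using congrFun (hv (m + a j)) j

/-- An additive map that respects gradings commutes with taking homogeneous components; the
components of the target are given by projections `c k`. -/
theorem map_freeComponent {n : ℕ} {a : Fin n → ℤ} {M : Type*} [AddCommGroup M]
    (ℳ : ℤ → Set M) (c : ℤ → M →+ M) (c_mem : ∀ k, ∀ m ∈ ℳ k, c k m = m)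
    (c_ne : ∀ j k, j ≠ k → ∀ m ∈ ℳ j, c k m = 0) (φ : (Fin n → PolyRing) →+ M)
    (hφ : ∀ k, ∀ v ∈ freePiece a k, φ v ∈ ℳ k) (k : ℤ) (v : Fin n → PolyRing) :
    φ (freeComponent a k v) = c k (φ v) := by
  refine freePiece_induction a (motive := fun v => φ (freeComponent a k v) = c k (φ v))
    (fun j v hv => ?_) (fun v w hv hw => by simp [hv, hw]) v
  rcases eq_or_ne j k with rfl | hjk
  · rw [freeComponent_of_mem hv, c_mem _ _ (hφ _ _ hv)]
  · rw [freeComponent_of_mem_ne hjk hv, c_ne _ _ hjk _ (hφ _ _ hv), map_zero]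

theorem IsGradedMap.map_freeComponent {m n : ℕ} {a : Fin m → ℤ} {b : Fin n → ℤ}
    {φ : (Fin m → PolyRing) →ₗ[PolyRing] (Fin n → PolyRing)} (hφ : IsGradedMap a b φ) (k : ℤ)
    (v : Fin m → PolyRing) : φ (freeComponent a k v) = freeComponent b k (φ v) :=
  PlaneCurve.map_freeComponent (fun k => (freePiece b k : Set (Fin n → PolyRing)))
    (fun k => (freeComponent b k).toAddMonoidHom)
    (fun _ _ h => freeComponent_of_mem h)
    (fun _ _ hjk _ h => freeComponent_of_mem_ne hjk h)
    φ.toAddMonoidHom hφ k v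

theorem single_mem_freePiece {n : ℕ} (a : Fin n → ℤ) (j : Fin n) :
    (Pi.single j 1 : Fin n → PolyRing) ∈ freePiece a (a j) := by
  refine mem_freePiece.2 fun i => ?_
  rcases eq_or_ne i j with rfl | hij
  · simpa using mem_gradedPiece_natCast.2 (isHomogeneous_one (Fin 3) ℂ)
  · simp [hij]

/-- A linear map between graded free modules is graded as soon as it sends the basis vectors to
elements of the right degrees. -/
theorem isGradedMap_of_single {m n : ℕ} {a : Fin m → ℤ} {b : Fin n → ℤ}
    {φ : (Fin m → PolyRing) →ₗ[PolyRing] (Fin n → PolyRing)}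
    (h : ∀ j, φ (Pi.single j 1) ∈ freePiece b (a j)) : IsGradedMap a b φ := by
  intro k v hv
  rw [pi_eq_sum_univ' v, map_sum]
  refine Submodule.sum_mem _ fun j _ => mem_freePiece.2 fun i => ?_
  have := mul_mem_gradedPiece (mem_freePiece.1 hv j) (mem_freePiece.1 (h j) i)
  rw [show k - b i = k - a j + (a j - b i) by ring]
  simpa [Pi.single, Function.update, eq_comm] using this

theorem IsGradedMap.comp {l m n : ℕ} {a : Fin l → ℤ} {b : Fin m → ℤ} {c : Fin n → ℤ}
    {φ : (Fin m → PolyRing) →ₗ[PolyRing] (Fin n → PolyRing)}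
    {ψ : (Fin l → PolyRing) →ₗ[PolyRing] (Fin m → PolyRing)}
    (hφ : IsGradedMap b c φ) (hψ : IsGradedMap a b ψ) : IsGradedMap a c (φ ∘ₗ ψ) :=
  fun k v hv => hφ k _ (hψ k v hv)

/-- A graded map from a graded free module lifts through a map that is surjective in each
degree. -/
theorem exists_graded_lift {m n : ℕ} {a : Fin m → ℤ} {b : Fin n → ℤ} {M : Type*} [AddCommGroup M]
    [Module PolyRing M] (ℳ : ℤ → Set M) (φ : (Fin m → PolyRing) →ₗ[PolyRing] M)
    (hφ : ∀ k, ∀ v ∈ freePiece a k, φ v ∈ ℳ k) (π : (Fin n → PolyRing) →ₗ[PolyRing] M)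
    (hπ : ∀ k, ∀ x ∈ ℳ k, x ∈ LinearMap.range φ → ∃ w ∈ freePiece b k, π w = x) :
    ∃ ψ : (Fin m → PolyRing) →ₗ[PolyRing] (Fin n → PolyRing), IsGradedMap a b ψ ∧ π ∘ₗ ψ = φ := by
  choose w hw hπw using fun j => hπ (a j) _ (hφ _ _ (single_mem_freePiece a j)) ⟨_, rfl⟩
  refine ⟨(Pi.basisFun PolyRing (Fin m)).constr PolyRing w,
    isGradedMap_of_single fun j => ?_, (Pi.basisFun PolyRing (Fin m)).ext fun j => ?_⟩
  · rw [← Pi.basisFun_apply, Module.Basis.constr_basis]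
    exact hw j
  · rw [LinearMap.comp_apply, Module.Basis.constr_basis, hπw, Pi.basisFun_apply]

theorem IsGradedMap.exists_lift {l m n : ℕ} {a : Fin l → ℤ} {b : Fin m → ℤ} {c : Fin n → ℤ}
    {φ : (Fin l → PolyRing) →ₗ[PolyRing] (Fin n → PolyRing)} (hφ : IsGradedMap a c φ)
    {π : (Fin m → PolyRing) →ₗ[PolyRing] (Fin n → PolyRing)} (hπ : IsGradedMap b c π)
    (h : LinearMap.range φ ≤ LinearMap.range π) :
    ∃ ψ : (Fin l → PolyRing) →ₗ[PolyRing] (Fin m → PolyRing), IsGradedMap a b ψ ∧ π ∘ₗ ψ = φ := by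
  refine exists_graded_lift (fun k => (freePiece c k : Set (Fin n → PolyRing))) φ hφ π
    fun k x hx hxφ => ?_
  obtain ⟨w, rfl⟩ := h hxφ
  exact ⟨freeComponent b k w, freeComponent_mem _ _ _,
    by rw [hπ.map_freeComponent, freeComponent_of_mem hx]⟩

/-- Free modules are projective: a map into the range of `π` lifts through `π`. -/
theorem exists_lift {m n : ℕ} {M : Type*} [AddCommGroup M] [Module PolyRing M]
    (φ : (Fin m → PolyRing) →ₗ[PolyRing] M) (π : (Fin n → PolyRing) →ₗ[PolyRing] M)
    (h : ∀ v, φ v ∈ LinearMap.range π) :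
    ∃ ψ : (Fin m → PolyRing) →ₗ[PolyRing] (Fin n → PolyRing), ∀ v, π (ψ v) = φ v := by
  obtain ⟨ψ, hψ⟩ := Module.projective_lifting_property π.rangeRestrict (φ.codRestrict _ h)
    π.surjective_rangeRestrict
  exact ⟨ψ, fun v => by simpa using congrArg Subtype.val (LinearMap.congr_fun hψ v)⟩

theorem constantCoeff_map_eq_zero {m n : ℕ}
    (φ : (Fin m → PolyRing) →ₗ[PolyRing] (Fin n → PolyRing)) {v : Fin m → PolyRing}
    (hv : ∀ j, constantCoeff (v j) = 0) (i : Fin n) : constantCoeff (φ v i) = 0 := by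
  rw [pi_eq_sum_univ' v, map_sum, Finset.sum_apply, map_sum]
  exact Finset.sum_eq_zero fun j _ => by simp [hv]

/-! ### Comparison of resolutions -/

section Comparison

variable {M : Type*} [AddCommGroup M] [Module PolyRing M] [Module ℂ M] {ℳ : ℤ → Submodule ℂ M}

/-- The augmentation of a graded resolution is surjective in each degree, provided that the
subspaces `ℳ k` have projections `c k`. -/
theorem MinimalGradedFreeResolution.exists_aug_eq (F : MinimalGradedFreeResolution ℳ)
    (c : ℤ → M →+ M) (c_mem : ∀ k, ∀ m ∈ ℳ k, c k m = m)
    (c_ne : ∀ j k, j ≠ k → ∀ m ∈ ℳ j, c k m = 0) {k : ℤ} {m : M} (hm : m ∈ ℳ k) :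
    ∃ w ∈ freePiece (F.shift 0) k, F.aug w = m := by
  obtain ⟨w, rfl⟩ := F.aug_surjective m
  refine ⟨freeComponent _ k w, freeComponent_mem _ _ _, ?_⟩
  exact (map_freeComponent (fun k => ℳ k) c c_mem c_ne F.aug.toAddMonoidHom F.aug_graded k w).trans
    (c_mem _ _ hm)

/-- The comparison theorem for two resolutions `F` and `P`, in the form of an induction on the
homological degree `i`: comparison maps `α`, `β` in degree `i`, which carry boundaries to
boundaries, and a homotopy `s` from `β ∘ α` to the identity. By minimality, `β ∘ α` is the identity
modulo `(x, y, z)`. -/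
theorem MinimalGradedFreeResolution.exists_comparison (F P : MinimalGradedFreeResolution ℳ)
    (c : ℤ → M →+ M) (c_mem : ∀ k, ∀ m ∈ ℳ k, c k m = m)
    (c_ne : ∀ j k, j ≠ k → ∀ m ∈ ℳ j, c k m = 0) (i : ℕ) :
    ∃ (α : (Fin (F.rank i) → PolyRing) →ₗ[PolyRing] (Fin (P.rank i) → PolyRing))
      (β : (Fin (P.rank i) → PolyRing) →ₗ[PolyRing] (Fin (F.rank i) → PolyRing))
      (s : (Fin (F.rank i) → PolyRing) →ₗ[PolyRing] (Fin (F.rank (i + 1)) → PolyRing)),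
      IsGradedMap (F.shift i) (P.shift i) α ∧ IsGradedMap (P.shift i) (F.shift i) β ∧
      (∀ x ∈ LinearMap.range (F.diff i), α x ∈ LinearMap.range (P.diff i)) ∧
      (∀ x ∈ LinearMap.range (P.diff i), β x ∈ LinearMap.range (F.diff i)) ∧
      (∀ x ∈ LinearMap.range (F.diff i), β (α x) - x = F.diff i (s x)) ∧
      ∀ v j, constantCoeff (β (α v) j) = constantCoeff (v j) := by
  induction i with
  | zero =>
    obtain ⟨α, hα, hαc⟩ := exists_graded_lift (fun k => ℳ k) F.aug F.aug_graded P.aug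
      fun k x hx _ => P.exists_aug_eq c c_mem c_ne hx
    obtain ⟨β, hβ, hβc⟩ := exists_graded_lift (fun k => ℳ k) P.aug P.aug_graded F.aug
      fun k x hx _ => F.exists_aug_eq c c_mem c_ne hx
    replace hαc := LinearMap.congr_fun hαc
    replace hβc := LinearMap.congr_fun hβc
    simp only [LinearMap.comp_apply] at hαc hβc
    obtain ⟨s, hs⟩ := exists_lift (β ∘ₗ α - LinearMap.id) (F.diff 0) fun v => by
      refine (F.exact_zero _).1 ?_
      simp [hαc, hβc]
    simp only [LinearMap.sub_apply, LinearMap.comp_apply, LinearMap.id_apply] at hs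
    refine ⟨α, β, s, hα, hβ, ?_, ?_, fun x _ => (hs x).symm, fun v j => ?_⟩
    · intro x hx
      refine (P.exact_zero _).1 ?_
      rw [hαc]
      exact (F.exact_zero _).2 hx
    · intro x hx
      refine (F.exact_zero _).1 ?_
      rw [hβc]
      exact (P.exact_zero _).2 hx
    · have := F.minimal 0 (s v) j
      rwa [hs, Pi.sub_apply, map_sub, sub_eq_zero] at this
  | succ i ih =>
    obtain ⟨α, β, s, hα, hβ, hαr, hβr, hs, -⟩ := ih
    obtain ⟨α', hα', hαc⟩ := (hα.comp (F.diff_graded i)).exists_lift (P.diff_graded i) (by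
      rintro _ ⟨v, rfl⟩
      exact hαr _ ⟨v, rfl⟩)
    obtain ⟨β', hβ', hβc⟩ := (hβ.comp (P.diff_graded i)).exists_lift (F.diff_graded i) (by
      rintro _ ⟨v, rfl⟩
      exact hβr _ ⟨v, rfl⟩)
    replace hαc := LinearMap.congr_fun hαc
    replace hβc := LinearMap.congr_fun hβc
    simp only [LinearMap.comp_apply] at hαc hβc
    obtain ⟨s', hs'⟩ := exists_lift (β' ∘ₗ α' - LinearMap.id - s ∘ₗ F.diff i) (F.diff (i + 1))
      fun v => by
        refine (F.exact_succ i _).1 ?_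
        simp [hαc, hβc, ← hs (F.diff i v) ⟨v, rfl⟩]
    simp only [LinearMap.sub_apply, LinearMap.comp_apply, LinearMap.id_apply] at hs'
    refine ⟨α', β', s', hα', hβ', ?_, ?_, ?_, fun v j => ?_⟩
    · intro x hx
      refine (P.exact_succ i _).1 ?_
      rw [hαc, (F.exact_succ i _).2 hx, map_zero]
    · intro x hx
      refine (F.exact_succ i _).1 ?_
      rw [hβc, (P.exact_succ i _).2 hx, map_zero]
    · intro x hx
      rw [hs', (F.exact_succ i _).2 hx, map_zero, sub_zero]
    · have h1 := F.minimal (i + 1) (s' v) j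
      have h2 := constantCoeff_map_eq_zero s (F.minimal i v) j
      rw [hs', Pi.sub_apply, Pi.sub_apply, map_sub, map_sub, h2] at h1
      linear_combination h1

/-- Every shift of a minimal resolution occurs, in the same homological degree, in any other
one. -/
theorem MinimalGradedFreeResolution.exists_shift_eq (F P : MinimalGradedFreeResolution ℳ)
    (c : ℤ → M →+ M) (c_mem : ∀ k, ∀ m ∈ ℳ k, c k m = m)
    (c_ne : ∀ j k, j ≠ k → ∀ m ∈ ℳ j, c k m = 0) (i : ℕ) (j : Fin (F.rank i)) :
    ∃ j', P.shift i j' = F.shift i j := by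
  obtain ⟨α, β, s, hα, hβ, -, -, -, hid⟩ := F.exists_comparison P c c_mem c_ne i
  by_contra! hne
  have hmem := mem_freePiece.1 (hα _ _ (single_mem_freePiece (F.shift i) j))
  have h1 := hid (Pi.single j 1) j
  rw [pi_eq_sum_univ' (α (Pi.single j 1)), map_sum, Finset.sum_apply, map_sum,
    Finset.sum_eq_zero] at h1
  · simp at h1
  · intro j' _
    rw [map_smul, Pi.smul_apply, smul_eq_mul, map_mul,
      constantCoeff_eq_zero_of_mem_gradedPiece (sub_ne_zero.2 (hne j').symm) (hmem j'), zero_mul]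

theorem regularity_eq_of_resolution (P : MinimalGradedFreeResolution ℳ)
    (c : ℤ → M →+ M) (c_mem : ∀ k, ∀ m ∈ ℳ k, c k m = m)
    (c_ne : ∀ j k, j ≠ k → ∀ m ∈ ℳ j, c k m = 0) {ρ : ℤ}
    (hle : ∀ i j, P.shift i j - (i : ℤ) ≤ ρ) (heq : ∃ i j, P.shift i j - (i : ℤ) = ρ) :
    regularity ℳ = ((ρ : ℝ) : EReal) := by
  apply le_antisymm
  · refine iSup_le fun F => iSup_le fun i => iSup_le fun j => ?_
    obtain ⟨j', hj'⟩ := F.exists_shift_eq P c c_mem c_ne i j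
    rw [← hj']
    exact_mod_cast hle i j'
  · obtain ⟨i, j, rfl⟩ := heq
    exact le_iSup_of_le P (le_iSup_of_le i (le_iSup_of_le j le_rfl))

end Comparison

/-! ### Minimal covers and resolutions -/

/-- An element of a graded free module is the sum of its homogeneous components. -/
theorem exists_sum_freeComponent {n : ℕ} (a : Fin n → ℤ) (v : Fin n → PolyRing) :
    ∃ T : Finset ℤ, v = ∑ k ∈ T, freeComponent a k v := by
  suffices h : ∃ T : Finset ℤ, ∀ T', T ⊆ T' → v = ∑ k ∈ T', freeComponent a k v by
    obtain ⟨T, hT⟩ := h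
    exact ⟨T, hT T subset_rfl⟩
  classical
  refine freePiece_induction a
    (motive := fun v => ∃ T : Finset ℤ, ∀ T', T ⊆ T' → v = ∑ k ∈ T', freeComponent a k v)
    (fun k v hv => ⟨{k}, fun T' hT' => ?_⟩) ?_ v
  · rw [Finset.sum_eq_single_of_mem k (hT' (Finset.mem_singleton_self k)) fun j _ hj =>
      freeComponent_of_mem_ne hj.symm hv, freeComponent_of_mem hv]
  · rintro v w ⟨T, hT⟩ ⟨U, hU⟩
    refine ⟨T ∪ U, fun T' hT' => ?_⟩
    simp only [map_add, Finset.sum_add_distrib]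
    rw [← hT T' (Finset.union_subset_left hT'), ← hU T' (Finset.union_subset_right hT')]

/-- A submodule of `⨁ j, S(-a j)` is graded if it contains the homogeneous components of its
elements. -/
def IsGradedSubmodule {n : ℕ} (a : Fin n → ℤ) (K : Submodule PolyRing (Fin n → PolyRing)) : Prop :=
  ∀ k, ∀ v ∈ K, freeComponent a k v ∈ K

theorem IsGradedMap.isGradedSubmodule_ker {m n : ℕ} {a : Fin m → ℤ} {b : Fin n → ℤ}
    {φ : (Fin m → PolyRing) →ₗ[PolyRing] (Fin n → PolyRing)} (hφ : IsGradedMap a b φ) :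
    IsGradedSubmodule a (LinearMap.ker φ) := fun k v hv => by
  rw [LinearMap.mem_ker] at hv ⊢
  rw [hφ.map_freeComponent, hv, map_zero]

theorem IsGradedSubmodule.exists_homogeneous_generators {n : ℕ} {a : Fin n → ℤ}
    {K : Submodule PolyRing (Fin n → PolyRing)} (hK : IsGradedSubmodule a K) :
    ∃ (m : ℕ) (b : Fin m → ℤ) (w : Fin m → Fin n → PolyRing),
      (∀ j, w j ∈ freePiece a (b j)) ∧ Submodule.span PolyRing (Set.range w) = K := by
  let H : Set (Fin n → PolyRing) := {v | v ∈ K ∧ ∃ k, v ∈ freePiece a k}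
  have hH : Submodule.span PolyRing H = K := by
    refine le_antisymm (Submodule.span_le.2 fun v hv => hv.1) fun v hv => ?_
    obtain ⟨T, hT⟩ := exists_sum_freeComponent a v
    rw [hT]
    exact Submodule.sum_mem _ fun k _ =>
      Submodule.subset_span ⟨hK k v hv, k, freeComponent_mem a k v⟩
  obtain ⟨s, hs, hspan⟩ :=
    (Submodule.fg_span_iff_fg_span_finset_subset _).1 (hH ▸ IsNoetherian.noetherian K :
      (Submodule.span PolyRing H).FG)
  choose b hb using fun x : s => (hs x.2).2
  refine ⟨s.card, fun j => b (s.equivFin.symm j), fun j => s.equivFin.symm j,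
    fun j => hb _, ?_⟩
  rw [← hH, hspan]
  congr 1
  ext x
  simp only [Set.mem_range]
  exact ⟨fun ⟨j, hj⟩ => hj ▸ (s.equivFin.symm j).2,
    fun hx => ⟨s.equivFin ⟨x, hx⟩, by simp⟩⟩

/-- A graded submodule has a minimal graded cover. It is given by a homogeneous system of
generators with the least number of elements. -/
theorem IsGradedSubmodule.exists_minimal_cover {n : ℕ} {a : Fin n → ℤ}
    {K : Submodule PolyRing (Fin n → PolyRing)} (hK : IsGradedSubmodule a K) :
    ∃ (m : ℕ) (b : Fin m → ℤ) (φ : (Fin m → PolyRing) →ₗ[PolyRing] (Fin n → PolyRing)),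
      IsGradedMap b a φ ∧ LinearMap.range φ = K ∧
      ∀ v, φ v = 0 → ∀ j, constantCoeff (v j) = 0 := by
  classical
  have hex := hK.exists_homogeneous_generators
  obtain ⟨b, w, hw, hspan⟩ := Nat.find_spec hex
  have hmin := fun m (h : m < Nat.find hex) => Nat.find_min hex h
  generalize Nat.find hex = m at b w hw hspan hmin
  have hgr : IsGradedMap b a (Fintype.linearCombination PolyRing w) :=
    isGradedMap_of_single fun j => by simpa using hw j
  refine ⟨m, b, Fintype.linearCombination PolyRing w, hgr,
    by rw [Fintype.range_linearCombination, hspan], fun v hv j => ?_⟩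
  by_contra hne
  -- In degree `b j`, the `j`-th coefficient of the relation `v` is a unit, so that `w j` is
  -- redundant.
  have hv' : Fintype.linearCombination PolyRing w (freeComponent b (b j) v) = 0 := by
    rw [hgr.map_freeComponent, hv, map_zero]
  have hcoeff : freeComponent b (b j) v j = C (constantCoeff (v j)) := by
    simp [freeComponent, component, homogeneousComponent_zero, constantCoeff_eq]
  rw [Fintype.linearCombination_apply] at hv'
  obtain _ | m := m
  · exact j.elim0
  rw [Fin.sum_univ_succAbove _ j, hcoeff, add_eq_zero_iff_eq_neg] at hv'
  refine hmin m (Nat.lt_succ_self m) ⟨fun i => b (j.succAbove i), fun i => w (j.succAbove i),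
    fun i => hw _, le_antisymm ?_ ?_⟩
  · rw [← hspan]
    exact Submodule.span_mono (Set.range_comp_subset_range _ w)
  · rw [← hspan, Submodule.span_le]
    rintro _ ⟨i, rfl⟩
    rcases Fin.eq_self_or_eq_succAbove j i with rfl | ⟨i, rfl⟩
    · have h : w i = (C (constantCoeff (v i))⁻¹ : PolyRing) •
          (C (constantCoeff (v i)) : PolyRing) • w i := by
        rw [smul_smul, ← C_mul, inv_mul_cancel₀ hne, C_1, one_smul]
      rw [h, hv']
      exact Submodule.smul_mem _ _ (Submodule.neg_mem _ (Submodule.sum_mem _ fun i _ =>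
        Submodule.smul_mem _ _ (Submodule.subset_span ⟨i, rfl⟩)))
    · exact Submodule.subset_span ⟨i, rfl⟩

/-- A graded free module of finite rank together with a graded submodule: a stage in the
construction of a minimal resolution. -/
structure SyzygyStage where
  rank : ℕ
  shift : Fin rank → ℤ
  syzygies : Submodule PolyRing (Fin rank → PolyRing)
  graded : IsGradedSubmodule shift syzygies

namespace SyzygyStage

/-- The free module that covers the syzygies minimally, with the kernel of the covering map. -/
noncomputable def next (s : SyzygyStage) : SyzygyStage where
  rank := s.graded.exists_minimal_cover.choose
  shift := s.graded.exists_minimal_cover.choose_spec.choose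
  syzygies := LinearMap.ker s.graded.exists_minimal_cover.choose_spec.choose_spec.choose
  graded :=
    s.graded.exists_minimal_cover.choose_spec.choose_spec.choose_spec.1.isGradedSubmodule_ker

/-- The minimal covering map of the syzygies. -/
noncomputable def cover (s : SyzygyStage) :
    (Fin s.next.rank → PolyRing) →ₗ[PolyRing] (Fin s.rank → PolyRing) :=
  s.graded.exists_minimal_cover.choose_spec.choose_spec.choose

theorem cover_graded (s : SyzygyStage) : IsGradedMap s.next.shift s.shift s.cover :=
  s.graded.exists_minimal_cover.choose_spec.choose_spec.choose_spec.1

theorem range_cover (s : SyzygyStage) : LinearMap.range s.cover = s.syzygies :=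
  s.graded.exists_minimal_cover.choose_spec.choose_spec.choose_spec.2.1

theorem constantCoeff_eq_zero_of_mem_next (s : SyzygyStage) :
    ∀ v ∈ s.next.syzygies, ∀ j, constantCoeff (v j) = 0 :=
  s.graded.exists_minimal_cover.choose_spec.choose_spec.choose_spec.2.2

/-- The stage reached from `s` after `i` minimal covers. -/
noncomputable def iterate (s : SyzygyStage) : ℕ → SyzygyStage
  | 0 => s
  | i + 1 => (s.iterate i).next

end SyzygyStage

/-- A minimal presentation `F₁ → F₀ → M → 0` such that the kernel of `F₁ → F₀` is contained in
`(x, y, z) F₁` extends to a minimal graded free resolution. -/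
theorem exists_resolution_extending {M : Type*} [AddCommGroup M] [Module PolyRing M] [Module ℂ M]
    {ℳ : ℤ → Submodule ℂ M} {n₀ n₁ : ℕ} {a₀ : Fin n₀ → ℤ} {a₁ : Fin n₁ → ℤ}
    (δ : (Fin n₁ → PolyRing) →ₗ[PolyRing] (Fin n₀ → PolyRing))
    (aug : (Fin n₀ → PolyRing) →ₗ[PolyRing] M) (hδ : IsGradedMap a₁ a₀ δ)
    (haug : ∀ k : ℤ, ∀ v ∈ freePiece a₀ k, aug v ∈ ℳ k) (hsurj : Function.Surjective aug)
    (hexact : Function.Exact δ aug) (hmin : IsMinimalMap δ)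
    (hker : ∀ v, δ v = 0 → ∀ j, constantCoeff (v j) = 0) :
    ∃ (F : MinimalGradedFreeResolution ℳ) (w : Fin (F.rank 2) → Fin n₁ → PolyRing),
      (∀ j, w j ∈ freePiece a₁ (F.shift 2 j)) ∧
      Submodule.span PolyRing (Set.range w) = LinearMap.ker δ := by
  let s : SyzygyStage := ⟨n₁, a₁, LinearMap.ker δ, hδ.isGradedSubmodule_ker⟩
  have hs : ∀ i, ∀ v ∈ (s.iterate i).syzygies, ∀ j, constantCoeff (v j) = 0
    | 0 => hker
    | i + 1 => (s.iterate i).constantCoeff_eq_zero_of_mem_next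
  let F : MinimalGradedFreeResolution ℳ :=
    { rank := fun i => match i with
        | 0 => n₀
        | i + 1 => (s.iterate i).rank
      shift := fun i => match i with
        | 0 => a₀
        | i + 1 => (s.iterate i).shift
      diff := fun i => match i with
        | 0 => δ
        | i + 1 => (s.iterate i).cover
      aug := aug
      diff_graded := fun i => match i with
        | 0 => hδ
        | i + 1 => (s.iterate i).cover_graded
      aug_graded := haug
      aug_surjective := hsurj
      exact_zero := hexact
      exact_succ := fun i => match i with
        | 0 => LinearMap.exact_iff.2 s.range_cover.symm
        | i + 1 => LinearMap.exact_iff.2 (s.iterate (i + 1)).range_cover.symm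
      minimal := fun i => match i with
        | 0 => hmin
        | i + 1 => fun v => hs i _ ((s.iterate i).range_cover ▸ LinearMap.mem_range_self _ v) }
  refine ⟨F, fun j => s.cover (Pi.single j 1),
    fun j => s.cover_graded _ _ (single_mem_freePiece _ j), ?_⟩
  have h := s.range_cover
  rw [LinearMap.range_eq_map, ← (Pi.basisFun PolyRing (Fin s.next.rank)).span_eq,
    Submodule.map_span, ← Set.range_comp] at h
  simp only [Function.comp_def, Pi.basisFun_apply] at h
  exact h

/-- A minimal graded free resolution of length at most three, from its maps. -/
noncomputable def MinimalGradedFreeResolution.ofLengthThree {M : Type*} [AddCommGroup M]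
    [Module PolyRing M] [Module ℂ M] {ℳ : ℤ → Submodule ℂ M} {n₀ n₁ n₂ n₃ : ℕ}
    {a₀ : Fin n₀ → ℤ} {a₁ : Fin n₁ → ℤ} {a₂ : Fin n₂ → ℤ} {a₃ : Fin n₃ → ℤ}
    (aug : (Fin n₀ → PolyRing) →ₗ[PolyRing] M)
    (δ₁ : (Fin n₁ → PolyRing) →ₗ[PolyRing] (Fin n₀ → PolyRing))
    (δ₂ : (Fin n₂ → PolyRing) →ₗ[PolyRing] (Fin n₁ → PolyRing))
    (δ₃ : (Fin n₃ → PolyRing) →ₗ[PolyRing] (Fin n₂ → PolyRing))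
    (haug : ∀ k : ℤ, ∀ v ∈ freePiece a₀ k, aug v ∈ ℳ k) (hsurj : Function.Surjective aug)
    (h₁ : IsGradedMap a₁ a₀ δ₁) (h₂ : IsGradedMap a₂ a₁ δ₂) (h₃ : IsGradedMap a₃ a₂ δ₃)
    (hm₁ : IsMinimalMap δ₁) (hm₂ : IsMinimalMap δ₂) (hm₃ : IsMinimalMap δ₃)
    (he₀ : Function.Exact δ₁ aug) (he₁ : Function.Exact δ₂ δ₁) (he₂ : Function.Exact δ₃ δ₂)
    (he₃ : Function.Injective δ₃) : MinimalGradedFreeResolution ℳ where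
  rank i := match i with
    | 0 => n₀
    | 1 => n₁
    | 2 => n₂
    | 3 => n₃
    | _ + 4 => 0
  shift i := match i with
    | 0 => a₀
    | 1 => a₁
    | 2 => a₂
    | 3 => a₃
    | _ + 4 => Fin.elim0
  diff i := match i with
    | 0 => δ₁
    | 1 => δ₂
    | 2 => δ₃
    | _ + 3 => 0
  aug := aug
  diff_graded i := match i with
    | 0 => h₁
    | 1 => h₂
    | 2 => h₃
    | _ + 3 => fun _ _ _ => zero_mem _
  aug_graded := haug
  aug_surjective := hsurj
  exact_zero := he₀
  exact_succ i := match i with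
    | 0 => he₁
    | 1 => he₂
    | 2 => fun _ => ⟨fun h => ⟨0, (he₃ (h.trans (map_zero δ₃).symm)).symm⟩,
        fun ⟨_, hw⟩ => hw ▸ map_zero δ₃⟩
    | _ + 3 => fun _ => ⟨fun _ => ⟨0, funext fun j => j.elim0⟩, fun _ => rfl⟩
  minimal i := match i with
    | 0 => hm₁
    | 1 => hm₂
    | 2 => hm₃
    | _ + 3 => fun _ _ => map_zero _

/-! ### The Milnor algebra -/

section Milnor

variable {f : PolyRing} {d : ℕ}

theorem pderiv_mem_gradedPiece (hf : f.IsHomogeneous d) (hd : 1 ≤ d) (i : Fin 3) :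
    pderiv i f ∈ gradedPiece (d - 1 : ℤ) := by
  rw [show (d - 1 : ℤ) = ((d - 1 : ℕ) : ℤ) by omega, mem_gradedPiece_natCast]
  exact hf.pderiv

theorem range_jacobianMap (f : PolyRing) : LinearMap.range (jacobianMap f) = jacobianIdeal f :=
  Fintype.range_linearCombination _ _

theorem jacobianMap_apply (f : PolyRing) (v : Fin 3 → PolyRing) :
    jacobianMap f v = v 0 * pderiv 0 f + v 1 * pderiv 1 f + v 2 * pderiv 2 f := by
  simp [jacobianMap, Fintype.linearCombination_apply, Fin.sum_univ_three]

theorem jacobianMap_mem_gradedPiece (hf : f.IsHomogeneous d) (hd : 1 ≤ d) {k : ℤ}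
    {v : Fin 3 → PolyRing} (hv : v ∈ freePiece (fun _ => (d - 1 : ℤ)) k) :
    jacobianMap f v ∈ gradedPiece k := by
  rw [jacobianMap, Fintype.linearCombination_apply]
  refine Submodule.sum_mem _ fun i _ => ?_
  have := mul_mem_gradedPiece (mem_freePiece.1 hv i) (pderiv_mem_gradedPiece hf hd i)
  rwa [sub_add_cancel] at this

theorem jacobianMap_freeComponent (hf : f.IsHomogeneous d) (hd : 1 ≤ d) (k : ℤ)
    (v : Fin 3 → PolyRing) :
    jacobianMap f (freeComponent (fun _ => (d - 1 : ℤ)) k v) = component k (jacobianMap f v) :=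
  map_freeComponent (fun k => (gradedPiece k : Set PolyRing))
    (fun k => (component k).toAddMonoidHom) (fun _ _ h => component_of_mem h)
    (fun _ _ hjk _ h => component_of_mem_ne hjk h) (jacobianMap f).toAddMonoidHom
    (fun _ _ hv => jacobianMap_mem_gradedPiece hf hd hv) k v

theorem component_mem_jacobianIdeal (hf : f.IsHomogeneous d) (hd : 1 ≤ d) (k : ℤ) {p : PolyRing}
    (hp : p ∈ jacobianIdeal f) : component k p ∈ jacobianIdeal f := by
  rw [← range_jacobianMap] at hp ⊢
  obtain ⟨v, rfl⟩ := hp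
  exact ⟨_, jacobianMap_freeComponent hf hd k v⟩

/-- The projections of the Milnor algebra to its graded pieces. -/
theorem exists_milnor_projections (hf : f.IsHomogeneous d) (hd : 1 ≤ d) :
    ∃ c : ℤ → MilnorAlgebra f →+ MilnorAlgebra f,
      (∀ k, ∀ m ∈ milnorPiece f k, c k m = m) ∧
      ∀ j k, j ≠ k → ∀ m ∈ milnorPiece f j, c k m = 0 := by
  have hmk : ∀ k p q, Ideal.Quotient.mk (jacobianIdeal f) p = Ideal.Quotient.mk _ q →
      Ideal.Quotient.mk (jacobianIdeal f) (component k p) =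
        Ideal.Quotient.mk _ (component k q) := fun k p q h => by
    rw [Ideal.Quotient.eq] at h ⊢
    rw [← map_sub]
    exact component_mem_jacobianIdeal hf hd k h
  have hsurj := Ideal.Quotient.mk_surjective (I := jacobianIdeal f)
  let c : ℤ → MilnorAlgebra f →+ MilnorAlgebra f := fun k => AddMonoidHom.mk'
    (fun m => Ideal.Quotient.mk _ (component k (Function.surjInv hsurj m))) fun m n => by
      rw [← map_add, ← map_add]
      exact hmk _ _ _ (by simp only [map_add, Function.surjInv_eq hsurj])
  have hc : ∀ k p, c k (Ideal.Quotient.mk _ p) = Ideal.Quotient.mk _ (component k p) := fun k p =>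
    hmk _ _ _ (Function.surjInv_eq hsurj _)
  refine ⟨c, ?_, ?_⟩
  · rintro k _ ⟨p, hp, rfl⟩
    exact (hc k p).trans (by rw [component_of_mem hp]; rfl)
  · rintro j k hjk _ ⟨p, hp, rfl⟩
    exact (hc k p).trans (by rw [component_of_mem_ne hjk hp, map_zero])

/-- The augmentation `S → M(f)`. -/
noncomputable def milnorAug (f : PolyRing) : (Fin 1 → PolyRing) →ₗ[PolyRing] MilnorAlgebra f :=
  (jacobianIdeal f).mkQ ∘ₗ LinearMap.proj 0

theorem milnorAug_surjective (f : PolyRing) : Function.Surjective (milnorAug f) :=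
  (Submodule.mkQ_surjective _).comp (LinearMap.proj_surjective 0)

theorem milnorAug_graded (f : PolyRing) (k : ℤ) :
    ∀ v ∈ freePiece (fun _ : Fin 1 => (0 : ℤ)) k, milnorAug f v ∈ milnorPiece f k := fun v hv =>
  ⟨v 0, by simpa using mem_freePiece.1 hv 0, rfl⟩

/-- The map `S^n → S` (with target written as `Fin 1 → S`) given by a row `g`. -/
noncomputable def rowMap {n : ℕ} (g : Fin n → PolyRing) :
    (Fin n → PolyRing) →ₗ[PolyRing] (Fin 1 → PolyRing) :=
  LinearMap.pi fun _ => Fintype.linearCombination PolyRing g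

theorem rowMap_graded {n : ℕ} {g : Fin n → PolyRing} {a : Fin n → ℤ}
    (hg : ∀ j, g j ∈ gradedPiece (a j)) : IsGradedMap a (fun _ => 0) (rowMap g) :=
  isGradedMap_of_single fun j => mem_freePiece.2 fun _ => by simpa [rowMap] using hg j

theorem rowMap_minimal {n : ℕ} {g : Fin n → PolyRing} (hg : ∀ j, constantCoeff (g j) = 0) :
    IsMinimalMap (rowMap g) := fun v i => by
  simp [rowMap, Fintype.linearCombination_apply, hg]

theorem rowMap_exact_milnorAug {n : ℕ} {g : Fin n → PolyRing}
    (hg : Submodule.span PolyRing (Set.range g) = jacobianIdeal f) :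
    Function.Exact (rowMap g) (milnorAug f) := by
  intro v
  have h0 : milnorAug f v = 0 ↔ v 0 ∈ jacobianIdeal f := Ideal.Quotient.eq_zero_iff_mem
  rw [h0, ← hg, ← Fintype.range_linearCombination PolyRing g]
  refine ⟨fun ⟨w, hw⟩ => ⟨w, funext fun i => ?_⟩, fun ⟨w, hw⟩ => ⟨w, ?_⟩⟩
  · rw [Subsingleton.elim i 0]
    exact hw
  · rw [← hw]
    rfl

theorem rowMap_eq_zero_iff {n : ℕ} {g : Fin n → PolyRing} {v : Fin n → PolyRing} :
    rowMap g v = 0 ↔ Fintype.linearCombination PolyRing g v = 0 :=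
  ⟨fun h => congrFun h 0, fun h => funext fun _ => h⟩

/-- The regularity of `M(f)` is read off from any minimal resolution of length at most three. -/
theorem reg_eq_of_resolution (hf : f.IsHomogeneous d) (hd : 1 ≤ d) {n₁ n₂ n₃ : ℕ}
    {a₁ : Fin n₁ → ℤ} {a₂ : Fin n₂ → ℤ} {a₃ : Fin n₃ → ℤ} {g : Fin n₁ → PolyRing}
    (hg : Submodule.span PolyRing (Set.range g) = jacobianIdeal f)
    (hgg : ∀ j, g j ∈ gradedPiece (a₁ j)) (hgm : ∀ j, constantCoeff (g j) = 0)
    {δ₂ : (Fin n₂ → PolyRing) →ₗ[PolyRing] (Fin n₁ → PolyRing)}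
    {δ₃ : (Fin n₃ → PolyRing) →ₗ[PolyRing] (Fin n₂ → PolyRing)}
    (h₂ : IsGradedMap a₂ a₁ δ₂) (h₃ : IsGradedMap a₃ a₂ δ₃)
    (hm₂ : IsMinimalMap δ₂) (hm₃ : IsMinimalMap δ₃)
    (he₁ : Function.Exact δ₂ (Fintype.linearCombination PolyRing g))
    (he₂ : Function.Exact δ₃ δ₂) (he₃ : Function.Injective δ₃) {ρ : ℤ}
    (hρ₀ : 0 ≤ ρ) (hρ₁ : ∀ j, a₁ j - 1 ≤ ρ) (hρ₂ : ∀ j, a₂ j - 2 ≤ ρ) (hρ₃ : ∀ j, a₃ j - 3 ≤ ρ)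
    (heq : (∃ j, a₂ j - 2 = ρ) ∨ ∃ j, a₃ j - 3 = ρ) : reg f = ((ρ : ℝ) : EReal) := by
  obtain ⟨c, hc, hc'⟩ := exists_milnor_projections hf hd
  refine regularity_eq_of_resolution (MinimalGradedFreeResolution.ofLengthThree (milnorAug f)
    (rowMap g) δ₂ δ₃ (milnorAug_graded f) (milnorAug_surjective f) (rowMap_graded hgg) h₂ h₃
    (rowMap_minimal hgm) hm₂ hm₃ (rowMap_exact_milnorAug hg)
    (fun v => rowMap_eq_zero_iff.trans (he₁ v)) he₂ he₃) c hc hc' (fun i => ?_) ?_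
  · match i with
    | 0 => exact fun _ => by simpa [MinimalGradedFreeResolution.ofLengthThree] using hρ₀
    | 1 => exact hρ₁
    | 2 => exact hρ₂
    | 3 => exact hρ₃
    | _ + 4 => exact fun j => j.elim0
  · rcases heq with ⟨j, hj⟩ | ⟨j, hj⟩
    · exact ⟨2, j, hj⟩
    · exact ⟨3, j, hj⟩

/-- If no nonzero Jacobian relation is constant, and the relations of degree at most `N` do not
generate `AR(f)`, then `S(-(d-1)-(N+1))`, or a summand with a larger shift, occurs in the second
module of a minimal resolution. -/
theorem le_reg_of_not_generated (hf : f.IsHomogeneous d) (hd : 2 ≤ d)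
    (hmin : ∀ v ∈ AR f, ∀ j, constantCoeff (v j) = 0) {N : ℤ}
    (hN : Submodule.span PolyRing {v | v ∈ AR f ∧ ∃ k ≤ N, ∀ i, v i ∈ gradedPiece k} ≠ AR f) :
    (((d + N - 2 : ℤ) : ℝ) : EReal) ≤ reg f := by
  have hgr := pderiv_mem_gradedPiece hf (by omega : 1 ≤ d)
  obtain ⟨F, w, hw, hspan⟩ := exists_resolution_extending (ℳ := milnorPiece f)
    (rowMap fun i => pderiv i f) (milnorAug f)
    (rowMap_graded (a := fun _ => (d - 1 : ℤ)) hgr) (milnorAug_graded f) (milnorAug_surjective f)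
    (rowMap_exact_milnorAug rfl)
    (rowMap_minimal fun i => constantCoeff_eq_zero_of_mem_gradedPiece (by omega) (hgr i))
    (fun v hv => hmin v (rowMap_eq_zero_iff.1 hv))
  have hker : LinearMap.ker (rowMap fun i => pderiv i f) = AR f :=
    Submodule.ext fun v => rowMap_eq_zero_iff
  rw [hker] at hspan
  by_contra! hlt
  refine hN (le_antisymm (Submodule.span_le.2 fun v hv => hv.1)
    (hspan.ge.trans (Submodule.span_le.2 ?_)))
  rintro _ ⟨j, rfl⟩
  have hmem : w j ∈ AR f := by
    rw [← hspan]
    exact Submodule.subset_span ⟨j, rfl⟩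
  refine Submodule.subset_span ⟨hmem, F.shift 2 j - (d - 1), ?_,
    fun i => mem_freePiece.1 (hw j) i⟩
  have h : (((F.shift 2 j - (2 : ℕ) : ℤ) : ℝ) : EReal) ≤ reg f :=
    le_iSup_of_le F (le_iSup_of_le 2 (le_iSup_of_le j le_rfl))
  have h' := h.trans_lt hlt
  norm_cast at h'
  omega

end Milnor

/-! ### Coprimality -/

/-- The entries of the vector `b` have no common prime factor. -/
def IsPrimitiveVector {n : ℕ} (b : Fin n → PolyRing) : Prop :=
  ∀ p, Prime p → ∃ j, ¬ p ∣ b j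

theorem IsPrimitiveVector.ne_zero {n : ℕ} {b : Fin n → PolyRing} (hb : IsPrimitiveVector b) :
    b ≠ 0 := by
  rintro rfl
  obtain ⟨j, hj⟩ := hb (X 0) X_prime
  exact hj (dvd_zero _)

theorem IsPrimitiveVector.isUnit_of_dvd {n : ℕ} {b : Fin n → PolyRing} (hb : IsPrimitiveVector b)
    {t : PolyRing} (ht : ∀ j, t ∣ b j) : IsUnit t := by
  by_contra hu
  have h0 : t ≠ 0 := by
    rintro rfl
    exact hb.ne_zero (funext fun j => zero_dvd_iff.1 (ht j))
  obtain ⟨p, hp, hpt⟩ := WfDvdMonoid.exists_irreducible_factor hu h0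
  obtain ⟨j, hj⟩ := hb p hp.prime
  exact hj (hpt.trans (ht j))

theorem IsPrimitiveVector.dvd_of_dvd_mul {n : ℕ} {b : Fin n → PolyRing}
    (hb : IsPrimitiveVector b) {a w : PolyRing} (h : ∀ j, a ∣ w * b j) : a ∣ w := by
  classical
  let : StrongNormalizationMonoid PolyRing := UniqueFactorizationMonoid.strongNormalizationMonoid
  let : NormalizedGCDMonoid PolyRing := UniqueFactorizationMonoid.toNormalizedGCDMonoid _
  have h1 : a ∣ Finset.univ.gcd fun j => w * b j := Finset.dvd_gcd fun j _ => h j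
  have h2 : IsUnit (Finset.univ.gcd b) :=
    hb.isUnit_of_dvd fun j => Finset.gcd_dvd (Finset.mem_univ j)
  exact (h2.dvd_mul_right).1 (h1.trans (Finset.gcd_mul_left' _ _ w).dvd)

/-- A vector parallel to a primitive vector is a multiple of it. -/
theorem IsPrimitiveVector.exists_eq_smul {b : Fin 3 → PolyRing} (hb : IsPrimitiveVector b)
    {w : Fin 3 → PolyRing} (h : b ⨯₃ w = 0) : ∃ t : PolyRing, w = t • b := by
  have hc : ∀ i j, w i * b j = w j * b i := by
    have h0 := congrFun h 0
    have h1 := congrFun h 1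
    have h2 := congrFun h 2
    simp [cross_apply] at h0 h1 h2
    intro i j
    fin_cases i <;> fin_cases j <;> simp <;>
    first
    | linear_combination h0
    | linear_combination h1
    | linear_combination h2
    | linear_combination -h0
    | linear_combination -h1
    | linear_combination -h2
  obtain ⟨i, hi⟩ := Function.ne_iff.1 hb.ne_zero
  obtain ⟨t, ht⟩ := hb.dvd_of_dvd_mul (a := b i) (w := w i) fun j => ⟨w j, by rw [hc, mul_comm]⟩
  refine ⟨t, funext fun j => mul_right_cancel₀ hi ?_⟩
  rw [hc j i, ht, Pi.smul_apply, smul_eq_mul]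
  ring

theorem totalDegree_pderiv_lt {p : PolyRing} {i : Fin 3} (h : pderiv i p ≠ 0) :
    (pderiv i p).totalDegree < p.totalDegree := by
  rw [totalDegree, Finset.sup_lt_iff]
  · intro m hm
    rw [mem_support_iff, coeff_pderiv] at hm
    have := le_totalDegree (mem_support_iff.2 (left_ne_zero_of_mul hm))
    rw [Finsupp.sum_add_index' (by simp) (by simp)] at this
    simp at this
    simp only [Finsupp.sum] at this ⊢
    omega
  · obtain ⟨m, hm⟩ := exists_coeff_ne_zero h
    rw [coeff_pderiv] at hm
    have := le_totalDegree (mem_support_iff.2 (left_ne_zero_of_mul hm))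
    rw [Finsupp.sum_add_index' (by simp) (by simp)] at this
    simp at this
    simp only [bot_eq_zero]
    omega

theorem exists_pderiv_ne_zero {p : PolyRing} (h : p.totalDegree ≠ 0) : ∃ i, pderiv i p ≠ 0 := by
  have hp : ∃ m ∈ p.support, m ≠ 0 := by
    by_contra! hm
    refine h ((totalDegree_eq_zero_iff _ p).2 fun m hm' i => ?_)
    simp [hm m hm']
  obtain ⟨m, hm, hm0⟩ := hp
  obtain ⟨i, hi⟩ := Finsupp.ne_iff.1 hm0
  refine ⟨i, ne_zero_iff.2 ⟨m - Finsupp.single i 1, ?_⟩⟩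
  rw [coeff_pderiv, tsub_add_cancel_of_le]
  · exact mul_ne_zero (mem_support_iff.1 hm) (Nat.cast_add_one_ne_zero _)
  · rw [Finsupp.single_le_iff]
    exact Nat.one_le_iff_ne_zero.2 hi

/-- The gradient `(f_x, f_y, f_z)`. -/
noncomputable def grad (f : PolyRing) : Fin 3 → PolyRing := fun i => pderiv i f

theorem mem_AR_iff {f : PolyRing} {v : Fin 3 → PolyRing} : v ∈ AR f ↔ v ⬝ᵥ grad f = 0 := by
  rw [AR, LinearMap.mem_ker, jacobianMap_apply, dotProduct, Fin.sum_univ_three]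
  rfl

theorem totalDegree_ne_zero_of_prime {p : PolyRing} (hp : Prime p) : p.totalDegree ≠ 0 := by
  intro h
  rw [totalDegree_eq_zero_iff_eq_C] at h
  refine hp.not_isUnit ?_
  rw [h]
  refine (isUnit_iff_ne_zero.2 fun h0 => hp.ne_zero ?_).map C
  rw [h, h0, C_0]

/-- The partial derivatives of a square-free form have no common factor: by Euler's identity such
a factor divides the form, and then it divides it twice. -/
theorem isPrimitiveVector_grad {f : PolyRing} {d : ℕ} (hf : f.IsHomogeneous d) (hd : 1 ≤ d)
    (hred : Squarefree f) : IsPrimitiveVector (grad f) := by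
  intro p hp
  by_contra! hdvd
  have hpf : p ∣ f := by
    have h : p ∣ C (d : ℂ) * f := by
      rw [← smul_eq_C_mul, Nat.cast_smul_eq_nsmul, ← hf.sum_X_mul_pderiv]
      exact Finset.dvd_sum fun i _ => (hdvd i).mul_left _
    have hu : IsUnit (C (d : ℂ) : PolyRing) :=
      (isUnit_iff_ne_zero.2 (Nat.cast_ne_zero.2 (by omega))).map C
    exact hu.dvd_mul_left.1 h
  obtain ⟨g, rfl⟩ := hpf
  have hpdeg := totalDegree_ne_zero_of_prime hp
  obtain ⟨i, hi⟩ := exists_pderiv_ne_zero hpdeg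
  have h1 : p ∣ pderiv i p * g := by
    have := hdvd i
    rw [grad, pderiv_mul] at this
    exact (dvd_add_left (dvd_mul_right p _)).1 this
  rcases hp.dvd_or_dvd h1 with h | ⟨g', rfl⟩
  · exact absurd (totalDegree_le_of_dvd_of_isDomain h hi) (not_le.2 (totalDegree_pderiv_lt hi))
  · exact hp.not_isUnit (hred p ⟨g', by ring⟩)

/-! ### Cross products of Jacobian relations -/

theorem cross_mem_gradedPiece {k l : ℤ} {u v : Fin 3 → PolyRing} (hu : ∀ i, u i ∈ gradedPiece k)
    (hv : ∀ i, v i ∈ gradedPiece l) (i : Fin 3) : (u ⨯₃ v) i ∈ gradedPiece (k + l) := by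
  rw [cross_apply]
  fin_cases i <;>
  exact Submodule.sub_mem _ (mul_mem_gradedPiece (hu _) (hv _)) (mul_mem_gradedPiece (hu _) (hv _))

theorem mem_gradedPiece_of_mul {k m : ℤ} {p q : PolyRing} (hq : q ∈ gradedPiece m) (hq0 : q ≠ 0)
    (h : p * q ∈ gradedPiece k) : p ∈ gradedPiece (k - m) := by
  have hmul := map_freeComponent (a := fun _ : Fin 1 => m) (fun k => (gradedPiece k : Set PolyRing))
    (fun k => (component k).toAddMonoidHom) (fun _ _ h => component_of_mem h)
    (fun _ _ hjk _ h => component_of_mem_ne hjk h)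
    ((AddMonoidHom.mulRight q).comp (Pi.evalAddMonoidHom _ 0))
    (fun j v hv => by simpa using mul_mem_gradedPiece (mem_freePiece.1 hv 0) hq) k fun _ => p
  have h1 : component (k - m) p * q = p * q := by
    simpa [freeComponent, component_of_mem h] using hmul
  rw [← mul_right_cancel₀ hq0 h1]
  exact component_mem _ _

theorem mem_gradedPiece_of_smul {k m : ℤ} {p : PolyRing} {u : Fin 3 → PolyRing}
    (hu : ∀ i, u i ∈ gradedPiece m) (hu0 : u ≠ 0) (h : ∀ i, (p • u) i ∈ gradedPiece k) :
    p ∈ gradedPiece (k - m) := by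
  obtain ⟨i, hi⟩ := Function.ne_iff.1 hu0
  exact mem_gradedPiece_of_mul (hu i) hi (h i)

section Relations

variable {f : PolyRing} {d : ℕ}

/-- The cross product of two Jacobian relations is a multiple of the gradient. -/
theorem exists_cross_eq_smul_grad (hprim : IsPrimitiveVector (grad f)) {u v : Fin 3 → PolyRing}
    (hu : u ∈ AR f) (hv : v ∈ AR f) : ∃ h : PolyRing, u ⨯₃ v = h • grad f := by
  refine hprim.exists_eq_smul ?_
  rw [cross_cross_eq_smul_sub_smul', mem_AR_iff.1 hu, dotProduct_comm, mem_AR_iff.1 hv]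
  simp

theorem cross_grad_mem_AR (w : Fin 3 → PolyRing) : grad f ⨯₃ w ∈ AR f :=
  mem_AR_iff.2 (by rw [dotProduct_comm, dot_self_cross])

/-- The cross products of the Koszul relations are `f_x ∇f`, `f_y ∇f`, `f_z ∇f`, so that the
multipliers of `∇f` in cross products have no common factor. -/
theorem isUnit_of_forall_cross (hprim : IsPrimitiveVector (grad f)) {t : PolyRing}
    (ht : ∀ u ∈ AR f, ∀ v ∈ AR f, ∃ h : PolyRing, u ⨯₃ v = (t * h) • grad f) : IsUnit t := by
  have key : ∀ (k : Fin 3) (w w' : Fin 3 → PolyRing),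
      (grad f ⨯₃ w) ⨯₃ (grad f ⨯₃ w') = grad f k • grad f → t ∣ grad f k := by
    intro k w w' h
    obtain ⟨g, hg⟩ := ht _ (cross_grad_mem_AR w) _ (cross_grad_mem_AR w')
    rw [h] at hg
    exact ⟨g, smul_left_injective _ hprim.ne_zero hg⟩
  refine hprim.isUnit_of_dvd fun k => ?_
  fin_cases k
  · refine key 0 ![0, 1, 0] ![0, 0, 1] ?_
    ext1 i
    fin_cases i <;> simp [cross_apply]; ring
  · refine key 1 ![0, 0, 1] ![1, 0, 0] ?_
    ext1 i
    fin_cases i <;> simp [cross_apply]; ring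
  · refine key 2 ![1, 0, 0] ![0, 1, 0] ?_
    ext1 i
    fin_cases i <;> simp [cross_apply]; ring

theorem freeComponent_mem_AR (hf : f.IsHomogeneous d) (hd : 1 ≤ d) (k : ℤ) {v : Fin 3 → PolyRing}
    (hv : v ∈ AR f) : freeComponent (fun _ => 0) k v ∈ AR f := by
  have h : freeComponent (fun _ => 0) k v =
      freeComponent (fun _ => (d - 1 : ℤ)) (k + (d - 1)) v := by
    simp [freeComponent]
  rw [AR, LinearMap.mem_ker] at hv ⊢
  rw [h, jacobianMap_freeComponent hf hd, hv, map_zero]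

/-- There is a nonzero homogeneous Jacobian relation of least degree `r`. -/
theorem exists_minimal_relation (hf : f.IsHomogeneous d) (hd : 1 ≤ d)
    (hprim : IsPrimitiveVector (grad f)) :
    ∃ r : ℕ, r ≤ d - 1 ∧ (∃ u ∈ AR f, u ≠ 0 ∧ ∀ i, u i ∈ gradedPiece r) ∧
      ∀ v ∈ AR f, v ≠ 0 → ∀ k : ℤ, (∀ i, v i ∈ gradedPiece k) → (r : ℤ) ≤ k := by
  classical
  have hkoszul : ∃ u ∈ AR f, u ≠ 0 ∧ ∀ i, u i ∈ gradedPiece ((d - 1 : ℕ) : ℤ) := by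
    have hdeg : ∀ (j i : Fin 3), (grad f ⨯₃ Pi.single j 1) i ∈ gradedPiece ((d - 1 : ℕ) : ℤ) :=
      fun j i => by
        have h := cross_mem_gradedPiece (k := (d - 1 : ℤ)) (l := 0) (pderiv_mem_gradedPiece hf hd)
          (mem_freePiece.1 (single_mem_freePiece (fun _ => 0) j)) i
        rwa [show (d - 1 + 0 : ℤ) = (d - 1 : ℕ) by omega] at h
    by_contra! hno
    have h0 : ∀ j, grad f ⨯₃ Pi.single j 1 = 0 := fun j => by
      by_contra hj
      obtain ⟨i, hi⟩ := hno _ (cross_grad_mem_AR _) hj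
      exact hi (hdeg j i)
    have h1 := h0 0
    have h2 := h0 1
    simp [cross_apply] at h1 h2
    refine hprim.ne_zero (funext fun i => ?_)
    fin_cases i
    · exact h2.2
    · exact h1.2
    · exact h1.1
  have hex : ∃ r : ℕ, ∃ u ∈ AR f, u ≠ 0 ∧ ∀ i, u i ∈ gradedPiece r := ⟨_, hkoszul⟩
  refine ⟨Nat.find hex, Nat.find_min' hex hkoszul, Nat.find_spec hex, fun v hv hv0 k hk => ?_⟩
  · obtain ⟨i, hi⟩ := Function.ne_iff.1 hv0
    obtain ⟨n, rfl, -⟩ := exists_nat_of_mem_gradedPiece (hk i) hi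
    exact_mod_cast Nat.find_min' hex ⟨v, hv, hv0, hk⟩

/-- A nonzero Jacobian relation of least degree is primitive. -/
theorem isPrimitiveVector_of_minimal (hf : f.IsHomogeneous d) (hd : 1 ≤ d) {r : ℕ}
    {u : Fin 3 → PolyRing} (hu : u ∈ AR f) (hu0 : u ≠ 0) (hur : ∀ i, u i ∈ gradedPiece r)
    (hmin : ∀ v ∈ AR f, v ≠ 0 → ∀ k : ℤ, (∀ i, v i ∈ gradedPiece k) → (r : ℤ) ≤ k) :
    IsPrimitiveVector u := by
  intro p hp
  by_contra! hdvd
  choose u' hu' using hdvd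
  have hsmul : u = p • u' := funext hu'
  have hAR : u' ∈ AR f := by
    rw [mem_AR_iff, hsmul, smul_dotProduct, smul_eq_mul] at hu
    exact mem_AR_iff.2 ((mul_eq_zero.1 hu).resolve_left hp.ne_zero)
  have hu'0 : u' ≠ 0 := by
    rintro rfl
    exact hu0 (by simp [hsmul])
  obtain ⟨k, hk⟩ := not_forall.1 (mt (eq_zero_of_freeComponent_eq_zero fun _ => 0) hu'0)
  have hrk := hmin _ (freeComponent_mem_AR hf hd k hAR) hk k fun i => by
    simpa using mem_freePiece.1 (freeComponent_mem (fun _ => 0) k u') i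
  lift k to ℕ using by omega
  obtain ⟨i, hi⟩ := Function.ne_iff.1 hk
  have hi' : homogeneousComponent k (u' i) ≠ 0 := by
    simpa [freeComponent, component] using hi
  have hk' : k ≤ (u' i).totalDegree := by
    by_contra! hlt
    exact hi' (homogeneousComponent_eq_zero _ _ hlt)
  have hi0 : u' i ≠ 0 := by
    intro h
    simp [h] at hi'
  have hpdeg := totalDegree_ne_zero_of_prime hp
  have h1 := totalDegree_mul_of_isDomain hp.ne_zero hi0
  rw [← hu', (mem_gradedPiece_natCast.1 (hur i)).totalDegree
    (hu' i ▸ mul_ne_zero hp.ne_zero hi0)] at h1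
  omega

end Relations

/-! ### Linear forms -/

/-- The linear form with the given coefficients. -/
noncomputable def linearForm : (Fin 3 → ℂ) →ₗ[ℂ] PolyRing := Fintype.linearCombination ℂ X

theorem linearForm_single (i : Fin 3) : linearForm (Pi.single i 1) = X i := by
  simp [linearForm]

theorem linearForm_mem (c : Fin 3 → ℂ) : linearForm c ∈ gradedPiece 1 := by
  rw [linearForm, Fintype.linearCombination_apply]
  exact Submodule.sum_mem _ fun i _ => Submodule.smul_mem _ _
    (mem_gradedPiece_natCast.2 (isHomogeneous_X ℂ i))

theorem linearForm_injective : Function.Injective linearForm :=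
  (linearIndependent_X (Fin 3) ℂ).fintypeLinearCombination_injective

theorem exists_linearForm_eq {h : PolyRing} (hh : h.IsHomogeneous 1) : ∃ c, linearForm c = h := by
  have h1 := hh.sum_X_mul_pderiv
  have h2 : ∀ i, ∃ c : ℂ, pderiv i h = C c := fun i =>
    ⟨_, totalDegree_eq_zero_iff_eq_C.1 ((totalDegree_zero_iff_isHomogeneous _).2 hh.pderiv)⟩
  choose c hc using h2
  refine ⟨c, ?_⟩
  rw [one_smul] at h1
  rw [← h1, linearForm, Fintype.linearCombination_apply]
  exact Finset.sum_congr rfl fun i _ => by rw [hc, smul_eq_C_mul, mul_comm]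

/-- Two linearly independent linear forms are coprime. -/
theorem isPrimitiveVector_linearForm {c c' : Fin 3 → ℂ} (h : LinearIndependent ℂ ![c, c']) :
    IsPrimitiveVector ![linearForm c, linearForm c'] := by
  intro p hp
  by_contra! hdvd
  obtain ⟨q, hq⟩ : p ∣ linearForm c := hdvd 0
  obtain ⟨q', hq'⟩ : p ∣ linearForm c' := hdvd 1
  have hconst : ∀ (e : Fin 3 → ℂ) (s : PolyRing), linearForm e = p * s → ∃ a : ℂ, s = C a := by
    intro e s hs
    refine ⟨_, totalDegree_eq_zero_iff_eq_C.1 ?_⟩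
    rcases eq_or_ne s 0 with rfl | hs0
    · simp
    have h1 := totalDegree_mul_of_isDomain hp.ne_zero hs0
    have h2 : (linearForm e).totalDegree ≤ 1 :=
      (mem_gradedPiece_natCast.1 (linearForm_mem e)).totalDegree_le
    have h3 := totalDegree_ne_zero_of_prime hp
    rw [← hs] at h1
    omega
  obtain ⟨a, rfl⟩ := hconst _ _ hq
  obtain ⟨a', rfl⟩ := hconst _ _ hq'
  rw [LinearIndependent.pair_iff] at h
  obtain ⟨rfl, h0⟩ := h a' (-a) (linearForm_injective (by
    rw [map_add, map_smul, map_smul, hq, hq', map_zero, smul_eq_C_mul, smul_eq_C_mul, C_neg]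
    ring))
  obtain rfl : c' = 0 := linearForm_injective (by
    rw [hq', map_zero (C : ℂ →+* PolyRing), mul_zero, map_zero])
  simpa using h 0 1 (by simp)

/-- The syzygies of two coprime polynomials. -/
theorem IsPrimitiveVector.exists_of_mul_add_mul_eq_zero {p q : PolyRing}
    (h : IsPrimitiveVector ![p, q]) {a b : PolyRing} (hab : a * p + b * q = 0) :
    ∃ t, a = -(t * q) ∧ b = t * p := by
  rcases eq_or_ne p 0 with rfl | hp
  · have hq : IsUnit q := h.isUnit_of_dvd (t := q) fun j => by fin_cases j <;> simp
    obtain ⟨q', hq'⟩ := hq.exists_left_inv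
    have hb : b = 0 := by simpa [hq.ne_zero] using hab
    exact ⟨-(a * q'), by linear_combination -a * hq', by simp [hb]⟩
  · obtain ⟨t, rfl⟩ : p ∣ b := h.dvd_of_dvd_mul fun j => by
      fin_cases j
      · exact dvd_mul_left _ _
      · exact ⟨-a, by simp; linear_combination hab⟩
    exact ⟨t, mul_right_cancel₀ hp (by linear_combination hab), by ring⟩

/-- Exactness of the Koszul complex of `x, y, z` in the middle. -/
theorem exists_cross_of_dotProduct_X_eq_zero {a : Fin 3 → PolyRing}
    (h : (X : Fin 3 → PolyRing) ⬝ᵥ a = 0) : ∃ w, a = (X : Fin 3 → PolyRing) ⨯₃ w := by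
  -- `σ` sets `z` to zero.
  let σ : PolyRing →ₐ[ℂ] PolyRing := aeval ![X 0, X 1, 0]
  have hσ : ∀ p, ∃ q, p = σ p + X 2 * q := by
    intro p
    have h1 : (Ideal.Quotient.mkₐ ℂ (Ideal.span {(X 2 : PolyRing)})).comp σ =
        Ideal.Quotient.mkₐ ℂ _ := by
      refine algHom_ext fun i => ?_
      fin_cases i
      · simp [σ]
      · simp [σ]
      · simp only [σ, Fin.reduceFinMk, AlgHom.comp_apply, aeval_X]
        exact Ideal.Quotient.eq.2 (Ideal.mem_span_singleton.2 ⟨-1, by simp⟩)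
    have h2 := DFunLike.congr_fun h1 p
    obtain ⟨q, hq⟩ := Ideal.mem_span_singleton.1 (Ideal.Quotient.eq.1 h2.symm)
    exact ⟨q, by rw [← hq]; exact (add_sub_cancel _ _).symm⟩
  rw [dotProduct, Fin.sum_univ_three] at h
  have h0 : X 0 * σ (a 0) + X 1 * σ (a 1) = 0 := by
    simpa [σ] using congrArg σ h
  obtain ⟨c, hc⟩ : X 1 ∣ σ (a 0) := by
    have h1 : X 1 ∣ X 0 * σ (a 0) := ⟨-σ (a 1), by linear_combination h0⟩
    refine (X_prime.dvd_or_dvd h1).resolve_left fun hd => ?_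
    rw [X_dvd_X] at hd
    simp at hd
  have hc1 : σ (a 1) = -(X 0 * c) := by
    refine mul_left_cancel₀ (X_ne_zero 1) ?_
    linear_combination h0 - X 0 * hc
  obtain ⟨b0, hb0⟩ := hσ (a 0)
  obtain ⟨b1, hb1⟩ := hσ (a 1)
  rw [hc] at hb0
  rw [hc1] at hb1
  have h2 : a 2 = -(X 0 * b0) - X 1 * b1 := by
    refine mul_left_cancel₀ (X_ne_zero 2) ?_
    linear_combination h - X 0 * hb0 - X 1 * hb1
  refine ⟨![b1, -b0, c], ?_⟩
  ext1 i
  fin_cases i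
  · simp [cross_apply]
    linear_combination hb0
  · simp [cross_apply]
    linear_combination hb1
  · simp [cross_apply]
    linear_combination h2

theorem isPrimitiveVector_X : IsPrimitiveVector (X : Fin 3 → PolyRing) := by
  intro p hp
  by_contra! hdvd
  have h := X_dvd_X (R := ℂ) (i := (0 : Fin 3)) (j := 1)
  have h0 := (hp.irreducible.associated_of_dvd X_prime.irreducible (hdvd 0))
  have := h.1 (h0.symm.dvd.trans (hdvd 1))
  simp at this

/-! ### Free curves -/

section Free

variable {f : PolyRing} {d : ℕ}

theorem isFreeCurve_of_span {u v : Fin 3 → PolyRing} {m n : ℕ} (hu : u ∈ AR f) (hv : v ∈ AR f)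
    (hum : ∀ i, u i ∈ gradedPiece m) (hvn : ∀ i, v i ∈ gradedPiece n) (hne : u ⨯₃ v ≠ 0)
    (hspan : ∀ w ∈ AR f, ∃ a b : PolyRing, w = a • u + b • v) : IsFreeCurve f := by
  have hli : LinearIndependent PolyRing ![(⟨u, hu⟩ : AR f), ⟨v, hv⟩] := by
    rw [LinearIndependent.pair_iff]
    intro s t hst
    replace hst : s • u + t • v = 0 := congrArg Subtype.val hst
    constructor
    · have h := congrArg (fun x => x ⨯₃ v) hst
      simp only [map_add, map_smul, LinearMap.add_apply, LinearMap.smul_apply, cross_self,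
        smul_zero, add_zero, map_zero, LinearMap.zero_apply] at h
      exact (smul_eq_zero.1 h).resolve_right hne
    · have h := congrArg (fun x => u ⨯₃ x) hst
      simp only [map_add, map_smul, cross_self, smul_zero, zero_add, map_zero] at h
      exact (smul_eq_zero.1 h).resolve_right hne
  refine ⟨![m, n], Module.Basis.mk hli fun w _ => ?_, fun j i => ?_⟩
  · obtain ⟨a, b, hab⟩ := hspan w w.2
    have hw : w = a • (⟨u, hu⟩ : AR f) + b • ⟨v, hv⟩ := Subtype.ext hab
    rw [hw]
    exact Submodule.add_mem _ (Submodule.smul_mem _ _ (Submodule.subset_span ⟨0, rfl⟩))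
      (Submodule.smul_mem _ _ (Submodule.subset_span ⟨1, rfl⟩))
  · rw [Module.Basis.mk_apply]
    fin_cases j
    · exact mem_gradedPiece_natCast.1 (hum i)
    · exact mem_gradedPiece_natCast.1 (hvn i)

theorem crossProduct_graded {u : Fin 3 → PolyRing} {r : ℤ} (hu : ∀ i, u i ∈ gradedPiece r) :
    IsGradedMap (fun _ => 0) (fun _ => -r) (crossProduct u) := fun k v hv =>
  mem_freePiece.2 fun i => by
    have := cross_mem_gradedPiece hu (fun i => mem_freePiece.1 hv i) i
    rwa [show k - -r = r + (k - 0) by ring]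

/-- Saito's criterion: two relations whose cross product is the gradient form a basis of
`AR(f)`. -/
theorem isFreeCurve_of_cross_eq_grad (hf : f.IsHomogeneous d) (hd : 1 ≤ d)
    (hprim : IsPrimitiveVector (grad f)) {r : ℕ} {u v : Fin 3 → PolyRing} (hu : u ∈ AR f)
    (hur : ∀ i, u i ∈ gradedPiece r) (huprim : IsPrimitiveVector u) (hv : v ∈ AR f)
    (huv : u ⨯₃ v = grad f) : IsFreeCurve f := by
  -- Only the component of `v` of the right degree matters.
  have hgrad : grad f ∈ freePiece (fun _ => (-r : ℤ)) (d - 1 - r : ℤ) := mem_freePiece.2 fun i => by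
    rw [show (d - 1 - r - -r : ℤ) = d - 1 by ring]
    exact pderiv_mem_gradedPiece hf hd i
  have hv' := freeComponent_mem_AR hf hd (d - 1 - r) hv
  have huv' : u ⨯₃ freeComponent (fun _ => 0) (d - 1 - r : ℤ) v = grad f := by
    rw [(crossProduct_graded hur).map_freeComponent, huv, freeComponent_of_mem hgrad]
  have hvdeg : ∀ i, freeComponent (fun _ => 0) (d - 1 - r : ℤ) v i ∈ gradedPiece (d - 1 - r) :=
    fun i => by simpa using mem_freePiece.1 (freeComponent_mem (fun _ => 0) (d - 1 - r) v) i
  generalize freeComponent (fun _ => 0) (d - 1 - r : ℤ) v = v' at hv' huv' hvdeg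
  have hv'0 : v' ≠ 0 := by
    rintro rfl
    exact hprim.ne_zero (by rw [← huv', map_zero])
  obtain ⟨i, hi⟩ := Function.ne_iff.1 hv'0
  obtain ⟨n, hn, -⟩ := exists_nat_of_mem_gradedPiece (hvdeg i) hi
  rw [hn] at hvdeg
  refine isFreeCurve_of_span hu hv' hur hvdeg (huv' ▸ hprim.ne_zero) fun w hw => ?_
  obtain ⟨h, hh⟩ := exists_cross_eq_smul_grad hprim hu hw
  obtain ⟨t, ht⟩ := huprim.exists_eq_smul (w := w - h • v') (by
    rw [map_sub, map_smul, huv', hh, sub_self])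
  exact ⟨t, h, by rw [← ht, sub_add_cancel]⟩

theorem isFreeCurve_of_constant_relation (hf : f.IsHomogeneous d) (hd : 1 ≤ d)
    (hprim : IsPrimitiveVector (grad f)) {u : Fin 3 → PolyRing} (hu : u ∈ AR f) (hu0 : u ≠ 0)
    (hur : ∀ i, u i ∈ gradedPiece 0) : IsFreeCurve f := by
  obtain ⟨i, hi⟩ := Function.ne_iff.1 hu0
  obtain ⟨c, hc⟩ : ∃ c : ℂ, u i = C c := ⟨_, totalDegree_eq_zero_iff_eq_C.1
    ((totalDegree_zero_iff_isHomogeneous _).2 (mem_gradedPiece_natCast.1 (hur i)))⟩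
  have hc0 : c ≠ 0 := by
    rintro rfl
    exact hi (by simpa using hc)
  have hcc : C c * C c⁻¹ = (1 : PolyRing) := by rw [← C_mul, mul_inv_cancel₀ hc0, C_1]
  refine isFreeCurve_of_cross_eq_grad hf hd hprim (r := 0) hu hur (fun p hp => ⟨i, fun hpi => ?_⟩)
    (cross_grad_mem_AR (Pi.single i (C c⁻¹))) ?_
  · rw [hc] at hpi
    exact hp.not_isUnit (isUnit_of_dvd_unit hpi (IsUnit.of_mul_eq_one _ hcc))
  · rw [cross_cross_eq_smul_sub_smul', dotProduct_comm (grad f), mem_AR_iff.1 hu,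
      dotProduct_single, hc, hcc]
    simp

end Free

/-! ### Curves whose Jacobian relations are generated in low degree -/

section LowDegree

variable {f : PolyRing} {d : ℕ}

/-- The coefficient vectors of the linear forms `l` such that `u × v = l ∇f` for a relation `v` of
degree `k`. -/
def linearMultipliers (f : PolyRing) (u : Fin 3 → PolyRing) (k : ℤ) : Submodule ℂ (Fin 3 → ℂ) where
  carrier := {c | ∃ v ∈ AR f, (∀ i, v i ∈ gradedPiece k) ∧ u ⨯₃ v = linearForm c • grad f}
  add_mem' := by
    rintro c c' ⟨v, hv, hvk, h⟩ ⟨v', hv', hvk', h'⟩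
    exact ⟨v + v', add_mem hv hv', fun i => add_mem (hvk i) (hvk' i), by
      rw [map_add, map_add, h, h', add_smul]⟩
  zero_mem' := ⟨0, zero_mem _, fun _ => zero_mem _, by simp⟩
  smul_mem' := by
    rintro a c ⟨v, hv, hvk, h⟩
    refine ⟨(C a : PolyRing) • v, Submodule.smul_mem _ _ hv, fun i => ?_, ?_⟩
    · rw [Pi.smul_apply, smul_eq_mul, ← smul_eq_C_mul]
      exact Submodule.smul_mem _ _ (hvk i)
    · rw [map_smul, h, map_smul, smul_smul, smul_eq_C_mul]

/-- The ideal of multipliers is not `(x, y, z)`: if `u × vᵢ = xᵢ ∇f` for `i = 0, 1, 2`, then the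
Koszul complex of `x, y, z` yields a relation `v` with `u × v = ∇f`. -/
theorem exists_cross_eq_grad_of_cross_eq_X {u : Fin 3 → PolyRing} (hu : u ∈ AR f)
    (huprim : IsPrimitiveVector u) {v : Fin 3 → Fin 3 → PolyRing} (hv : ∀ i, v i ∈ AR f)
    (huv : ∀ i, u ⨯₃ v i = (X i : PolyRing) • grad f) : ∃ v' ∈ AR f, u ⨯₃ v' = grad f := by
  have hpair : ∀ i j, ∃ g : PolyRing, (X i : PolyRing) • v j - (X j : PolyRing) • v i = g • u :=
    fun i j => huprim.exists_eq_smul (by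
      rw [map_sub, map_smul, map_smul, huv, huv, smul_comm, sub_self])
  obtain ⟨g0, hg0⟩ := hpair 1 2
  obtain ⟨g1, hg1⟩ := hpair 2 0
  obtain ⟨g2, hg2⟩ := hpair 0 1
  obtain ⟨i, hi⟩ := Function.ne_iff.1 huprim.ne_zero
  have hX : (X : Fin 3 → PolyRing) ⬝ᵥ ![g0, g1, g2] = 0 := by
    refine mul_right_cancel₀ hi ?_
    have h0 := congrFun hg0 i
    have h1 := congrFun hg1 i
    have h2 := congrFun hg2 i
    simp at h0 h1 h2
    simp only [dotProduct, Fin.sum_univ_three, Matrix.cons_val, zero_mul]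
    linear_combination -X 0 * h0 - X 1 * h1 - X 2 * h2
  obtain ⟨w, hw⟩ := exists_cross_of_dotProduct_X_eq_zero hX
  have hw0 := congrFun hw 0
  have hw1 := congrFun hw 1
  have hw2 := congrFun hw 2
  simp [cross_apply] at hw0 hw1 hw2
  have hdiv : ∀ k, ∃ t : PolyRing, (fun i => v i k - w i * u k) = t • (X : Fin 3 → PolyRing) :=
    fun k => isPrimitiveVector_X.exists_eq_smul (by
      have h0 := congrFun hg0 k
      have h1 := congrFun hg1 k
      have h2 := congrFun hg2 k
      simp at h0 h1 h2
      ext1 i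
      fin_cases i
      · simp [cross_apply]
        linear_combination h0 + u k * hw0
      · simp [cross_apply]
        linear_combination h1 + u k * hw1
      · simp [cross_apply]
        linear_combination h2 + u k * hw2)
  choose v' hv' using hdiv
  have hv0 : (X 0 : PolyRing) • v' = v 0 - w 0 • u := by
    funext k
    have := congrFun (hv' k) 0
    simp at this ⊢
    linear_combination -this
  refine ⟨v', ?_, smul_right_injective _ (X_ne_zero (R := ℂ) (0 : Fin 3)) ?_⟩
  · have h : (X 0 : PolyRing) • v' ∈ AR f := by
      rw [hv0]
      exact sub_mem (hv 0) (Submodule.smul_mem _ _ hu)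
    rw [mem_AR_iff, smul_dotProduct, smul_eq_mul] at h
    exact mem_AR_iff.2 ((mul_eq_zero.1 h).resolve_left (X_ne_zero 0))
  · change (X 0 : PolyRing) • (u ⨯₃ v') = (X 0 : PolyRing) • grad f
    rw [← map_smul, hv0, map_sub, map_smul, cross_self, huv, smul_zero, sub_zero]

/-- If the ideal of multipliers is generated by two independent linear forms, the curve is nearly
free. -/
theorem isNearlyFreeCurve_of_linearForms (hf : f.IsHomogeneous d) (hd : 2 ≤ d) {r e : ℕ}
    (hr : 1 ≤ r) (hre : r ≤ e) (hred : r + e = d) {u v₁ v₂ : Fin 3 → PolyRing} (hu : u ∈ AR f)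
    (huprim : IsPrimitiveVector u) (hur : ∀ i, u i ∈ gradedPiece r)
    (hv₁ : v₁ ∈ AR f) (hv₂ : v₂ ∈ AR f) (hve₁ : ∀ i, v₁ i ∈ gradedPiece e)
    (hve₂ : ∀ i, v₂ i ∈ gradedPiece e) {l₁ l₂ : PolyRing} (hl₁ : l₁ ∈ gradedPiece 1)
    (hl₂ : l₂ ∈ gradedPiece 1) (hlprim : IsPrimitiveVector ![l₁, l₂]) (hg : grad f ≠ 0)
    (huv₁ : u ⨯₃ v₁ = l₁ • grad f) (huv₂ : u ⨯₃ v₂ = l₂ • grad f)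
    (hspan : ∀ w ∈ AR f, ∃ a b c : PolyRing, w = a • u + b • v₁ + c • v₂) :
    IsNearlyFreeCurve f d := by
  obtain ⟨g, hg'⟩ := huprim.exists_eq_smul (w := l₁ • v₂ - l₂ • v₁) (by
    rw [map_sub, map_smul, map_smul, huv₁, huv₂, smul_comm, sub_self])
  have hgdeg : g ∈ gradedPiece (1 + e - r : ℤ) := mem_gradedPiece_of_smul hur huprim.ne_zero
    fun i => by
      rw [← hg']
      exact sub_mem (mul_mem_gradedPiece hl₁ (hve₂ i)) (mul_mem_gradedPiece hl₂ (hve₁ i))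
  have hψ : ∀ v, Fintype.linearCombination PolyRing ![![-g, -l₂, l₁]] v =
      v 0 • ![-g, -l₂, l₁] := fun v => by
    simp [Fintype.linearCombination_apply]
  have hφ : ∀ v, Fintype.linearCombination PolyRing ![u, v₁, v₂] v =
      v 0 • u + v 1 • v₁ + v 2 • v₂ := fun v => by
    simp [Fintype.linearCombination_apply, Fin.sum_univ_three]
  refine ⟨r, e, Fintype.linearCombination PolyRing ![![-g, -l₂, l₁]],
    Fintype.linearCombination PolyRing ![u, v₁, v₂], hr, hre, ?_, ?_, ?_, ?_, ?_, ?_, ?_, ?_⟩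
  · refine isGradedMap_of_single fun j => mem_freePiece.2 fun i => ?_
    rw [hψ]
    fin_cases j
    fin_cases i
    · simp
      rw [show (d + e - (d + r - 1) : ℤ) = 1 + e - r by ring]
      exact hgdeg
    · simpa using hl₂
    · simpa using hl₁
  · refine isGradedMap_of_single fun j => mem_freePiece.2 fun i => ?_
    fin_cases j
    · fin_cases i <;> simpa [hφ] using hur _
    · fin_cases i <;> simpa [hφ] using hve₁ _
    · fin_cases i <;> simpa [hφ] using hve₂ _
  · intro v i
    rw [hψ]
    fin_cases i
    · simp [constantCoeff_eq_zero_of_mem_gradedPiece (by omega) hgdeg]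
    · simp [constantCoeff_eq_zero_of_mem_gradedPiece (by omega) hl₂]
    · simp [constantCoeff_eq_zero_of_mem_gradedPiece (by omega) hl₁]
  · intro v i
    rw [hφ]
    simp [constantCoeff_eq_zero_of_mem_gradedPiece (by omega) (hur i),
      constantCoeff_eq_zero_of_mem_gradedPiece (by omega) (hve₁ i),
      constantCoeff_eq_zero_of_mem_gradedPiece (by omega) (hve₂ i)]
  · intro v
    have h := fun i => constantCoeff_eq_zero_of_mem_gradedPiece (k := (d - 1 : ℤ)) (by omega)
      (pderiv_mem_gradedPiece hf (by omega) i)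
    simp [jacobianMap_apply, h]
  · rw [injective_iff_map_eq_zero]
    intro v hv
    rw [hψ, smul_eq_zero] at hv
    refine funext fun i => ?_
    rw [Subsingleton.elim i 0]
    refine hv.resolve_right fun h => hlprim.ne_zero ?_
    have h1 := congrFun h 1
    have h2 := congrFun h 2
    simp at h1 h2
    simp [h1, h2]
  · intro v
    rw [hφ]
    constructor
    · intro h
      have hc := congrArg (fun x => u ⨯₃ x) h
      simp only [map_add, map_smul, cross_self, smul_zero, zero_add, huv₁, huv₂, map_zero,
        smul_smul, ← add_smul] at hc
      obtain ⟨t, h1, h2⟩ := hlprim.exists_of_mul_add_mul_eq_zero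
        ((smul_eq_zero.1 hc).resolve_right hg)
      have h0 : v 0 = -(t * g) := by
        refine smul_left_injective _ huprim.ne_zero ?_
        change v 0 • u = -(t * g) • u
        rw [neg_smul, mul_smul, ← hg', eq_neg_iff_add_eq_zero, ← h, h1, h2]
        module
      refine ⟨fun _ => t, ?_⟩
      rw [hψ]
      ext1 i
      fin_cases i
      · simp [h0]
      · simp [h1]
      · simp [h2]
    · rintro ⟨w, rfl⟩
      rw [hψ]
      have : g • u - l₁ • v₂ + l₂ • v₁ = 0 := by
        rw [← hg']
        module
      simp only [Pi.smul_apply, smul_eq_mul, Matrix.cons_val]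
      have h := congrArg (fun x => -w 0 • x) this
      simp only [smul_zero] at h
      rw [← h]
      module
  · intro v
    constructor
    · intro h
      obtain ⟨a, b, c, rfl⟩ := hspan v h
      exact ⟨![a, b, c], by simp [hφ]⟩
    · rintro ⟨w, rfl⟩
      rw [hφ]
      exact add_mem (add_mem (Submodule.smul_mem _ _ hu) (Submodule.smul_mem _ _ hv₁))
        (Submodule.smul_mem _ _ hv₂)

/-- If no relation `v` has `u × v = ∇f`, then a homogeneous relation `v` whose degree is at most
`e = d - r` is a multiple of `u`, or it has degree `e` and a linear multiplier. -/
theorem cross_eq_zero_or_exists_linearMultiplier (hf : f.IsHomogeneous d) (hd : 1 ≤ d)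
    (hprim : IsPrimitiveVector (grad f)) {r e : ℕ} (he : r + e = d) {u : Fin 3 → PolyRing}
    (hu : u ∈ AR f) (hur : ∀ i, u i ∈ gradedPiece r) (hno : ∀ v ∈ AR f, u ⨯₃ v ≠ grad f)
    {v : Fin 3 → PolyRing} (hv : v ∈ AR f) {k : ℤ} (hk : k ≤ (e : ℤ))
    (hvk : ∀ i, v i ∈ gradedPiece k) :
    u ⨯₃ v = 0 ∨ ∃ c ∈ linearMultipliers f u e, u ⨯₃ v = linearForm c • grad f := by
  obtain ⟨h, hh⟩ := exists_cross_eq_smul_grad hprim hu hv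
  have hdeg := mem_gradedPiece_of_smul (pderiv_mem_gradedPiece hf hd) hprim.ne_zero
    fun i => hh ▸ cross_mem_gradedPiece hur hvk i
  rcases eq_or_ne h 0 with rfl | h0
  · exact Or.inl (by rw [hh, zero_smul])
  obtain ⟨n, hn, hhn⟩ := exists_nat_of_mem_gradedPiece hdeg h0
  obtain rfl | rfl : n = 0 ∨ n = 1 := by omega
  · exfalso
    obtain ⟨a, rfl⟩ : ∃ a : ℂ, h = C a := ⟨_, totalDegree_eq_zero_iff_eq_C.1
      ((totalDegree_zero_iff_isHomogeneous _).2 hhn)⟩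
    have ha : a ≠ 0 := by
      rintro rfl
      exact h0 C_0
    refine hno ((C a⁻¹ : PolyRing) • v) (Submodule.smul_mem _ _ hv) ?_
    rw [map_smul, hh, smul_smul, ← C_mul, inv_mul_cancel₀ ha, C_1, one_smul]
  · obtain ⟨c, rfl⟩ := exists_linearForm_eq hhn
    obtain rfl : k = e := by push_cast at hn; omega
    exact Or.inr ⟨c, ⟨v, hv, hvk, hh⟩, hh⟩

/-- Generators of `AR(f)` from a basis of the space of linear multipliers. -/
theorem exists_eq_smul_add_sum {u : Fin 3 → PolyRing} (huprim : IsPrimitiveVector u) {e n : ℕ}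
    (hgen : Submodule.span PolyRing
      {v | v ∈ AR f ∧ ∃ k ≤ (e : ℤ), ∀ i, v i ∈ gradedPiece k} = AR f)
    (hgenform : ∀ v ∈ AR f, ∀ k ≤ (e : ℤ), (∀ i, v i ∈ gradedPiece k) →
      u ⨯₃ v = 0 ∨ ∃ c ∈ linearMultipliers f u e, u ⨯₃ v = linearForm c • grad f)
    (b : Module.Basis (Fin n) ℂ (linearMultipliers f u e)) {v : Fin n → Fin 3 → PolyRing}
    (huv : ∀ i, u ⨯₃ v i = linearForm (b i) • grad f) {w : Fin 3 → PolyRing} (hw : w ∈ AR f) :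
    ∃ (a : PolyRing) (t : Fin n → PolyRing), w = a • u + ∑ i, t i • v i := by
  have hle : AR f ≤ Submodule.span PolyRing {u} ⊔ Submodule.span PolyRing (Set.range v) := by
    refine hgen.ge.trans (Submodule.span_le.2 ?_)
    rintro w ⟨hw, k, hk, hwk⟩
    have hmem : ∀ z, u ⨯₃ z = 0 → z ∈ Submodule.span PolyRing {u} := fun z hz => by
      obtain ⟨t, rfl⟩ := huprim.exists_eq_smul hz
      exact Submodule.smul_mem _ _ (Submodule.mem_span_singleton_self u)
    rcases hgenform w hw k hk hwk with h | ⟨c, hc, h⟩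
    · exact Submodule.mem_sup_left (hmem w h)
    · obtain ⟨s, hs⟩ : ∃ s : Fin n → ℂ, c = ∑ i, s i • (b i : Fin 3 → ℂ) := by
        refine ⟨b.repr ⟨c, hc⟩, ?_⟩
        have h := congrArg (linearMultipliers f u e).subtype (b.sum_repr ⟨c, hc⟩)
        rw [map_sum] at h
        exact h.symm
      have h1 : u ⨯₃ (w - ∑ i, (C (s i) : PolyRing) • v i) = 0 := by
        rw [map_sub, h, map_sum, hs, map_sum, Finset.sum_smul, ← Finset.sum_sub_distrib]
        refine Finset.sum_eq_zero fun i _ => ?_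
        rw [map_smul, map_smul, huv, smul_smul, smul_eq_C_mul, sub_self]
      rw [← sub_add_cancel w (∑ i, (C (s i) : PolyRing) • v i)]
      exact add_mem (Submodule.mem_sup_left (hmem _ h1)) (Submodule.mem_sup_right
        (Submodule.sum_mem _ fun i _ => Submodule.smul_mem _ _ (Submodule.subset_span ⟨i, rfl⟩)))
  obtain ⟨y, hy, z, hz, rfl⟩ := Submodule.mem_sup.1 (hle hw)
  obtain ⟨a, rfl⟩ := Submodule.mem_span_singleton.1 hy
  obtain ⟨t, rfl⟩ := (Submodule.mem_span_range_iff_exists_fun PolyRing).1 hz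
  exact ⟨a, t, rfl⟩

/-- If `r` is the least degree of a Jacobian relation and `AR(f)` is generated by its elements of
degree at most `d - r`, then the curve is free or nearly free: the ideal of the multipliers `h` in
`u × v = h ∇f`, for a fixed relation `u` of degree `r`, is then generated by constants and linear
forms. -/
theorem isFreeCurve_or_isNearlyFreeCurve (hf : f.IsHomogeneous d) (hd : 2 ≤ d)
    (hprim : IsPrimitiveVector (grad f)) {r : ℕ} (hrd : r ≤ d - 1) {u : Fin 3 → PolyRing}
    (hu : u ∈ AR f) (hu0 : u ≠ 0) (hur : ∀ i, u i ∈ gradedPiece r)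
    (hmin : ∀ v ∈ AR f, v ≠ 0 → ∀ k : ℤ, (∀ i, v i ∈ gradedPiece k) → (r : ℤ) ≤ k)
    (hgen : Submodule.span PolyRing
      {v | v ∈ AR f ∧ ∃ k ≤ (d - r : ℤ), ∀ i, v i ∈ gradedPiece k} = AR f) :
    IsFreeCurve f ∨ IsNearlyFreeCurve f d := by
  refine or_iff_not_imp_left.2 fun hnf => ?_
  have huprim := isPrimitiveVector_of_minimal hf (by omega) hu hu0 hur hmin
  have hno : ∀ v ∈ AR f, u ⨯₃ v ≠ grad f := fun v hv h =>
    hnf (isFreeCurve_of_cross_eq_grad hf (by omega) hprim hu hur huprim hv h)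
  obtain ⟨e, he⟩ : ∃ e : ℕ, r + e = d := ⟨d - r, by omega⟩
  rw [show (d - r : ℤ) = e by omega] at hgen
  have hgenform := fun v hv k hk hvk => cross_eq_zero_or_exists_linearMultiplier hf (by omega)
    hprim he hu hur hno (v := v) hv (k := k) hk hvk
  obtain ⟨n, hn, ⟨b⟩⟩ : ∃ n, Module.finrank ℂ (linearMultipliers f u e) = n ∧
      Nonempty (Module.Basis (Fin n) ℂ (linearMultipliers f u e)) :=
    ⟨_, rfl, ⟨Module.finBasis ℂ _⟩⟩
  choose v hv hve huv using fun i => (b i).2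
  have hspan := fun w hw => exists_eq_smul_add_sum huprim hgen hgenform b huv (w := w) hw
  have hn3 : n ≤ 3 := by
    simpa [hn] using Submodule.finrank_le (linearMultipliers f u e)
  have hli : LinearIndependent ℂ fun i => (b i : Fin 3 → ℂ) :=
    b.linearIndependent.map' (linearMultipliers f u e).subtype (Submodule.ker_subtype _)
  interval_cases n
  · -- All relations are multiples of `u`, so that their cross products vanish.
    exfalso
    refine not_isUnit_zero (isUnit_of_forall_cross hprim (t := 0) fun w hw w' hw' => ⟨0, ?_⟩)
    obtain ⟨a, _, rfl⟩ := hspan w hw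
    obtain ⟨a', _, rfl⟩ := hspan w' hw'
    simp
  · refine absurd (isFreeCurve_of_span hu (hv 0) hur (hve 0) ?_ fun w hw => ?_) hnf
    · rw [huv]
      exact smul_ne_zero (fun h => hli.ne_zero 0 (linearForm_injective (h.trans (map_zero _).symm)))
        hprim.ne_zero
    · obtain ⟨a, t, rfl⟩ := hspan w hw
      exact ⟨a, t 0, by simp⟩
  · have hli' : LinearIndependent ℂ ![(b 0 : Fin 3 → ℂ), (b 1 : Fin 3 → ℂ)] := by
      convert hli using 1
      ext1 i
      fin_cases i <;> rfl
    have hr1 : 1 ≤ r := by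
      by_contra! hr0
      obtain rfl : r = 0 := by omega
      exact hnf (isFreeCurve_of_constant_relation hf (by omega) hprim hu hu0 hur)
    have hv0 : v 0 ≠ 0 := by
      intro h
      have := huv 0
      rw [h, map_zero] at this
      refine smul_ne_zero (fun h => hli.ne_zero 0 (linearForm_injective ?_)) hprim.ne_zero this.symm
      exact h.trans (map_zero _).symm
    refine isNearlyFreeCurve_of_linearForms hf hd hr1
      (by exact_mod_cast hmin _ (hv 0) hv0 e (hve 0)) he hu huprim hur (hv 0) (hv 1) (hve 0)
      (hve 1) (linearForm_mem _) (linearForm_mem _) (isPrimitiveVector_linearForm hli')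
      hprim.ne_zero (huv 0) (huv 1) fun w hw => ?_
    obtain ⟨a, t, rfl⟩ := hspan w hw
    exact ⟨a, t 0, t 1, by rw [Fin.sum_univ_two, add_assoc]⟩
  · exfalso
    have hX : ∀ i, ∃ w ∈ AR f, u ⨯₃ w = (X i : PolyRing) • grad f := by
      intro i
      have hi : (Pi.single i 1 : Fin 3 → ℂ) ∈ linearMultipliers f u e := by
        rw [Submodule.eq_top_of_finrank_eq (hn.trans (by simp))]
        trivial
      obtain ⟨w, hw, -, h⟩ := hi
      exact ⟨w, hw, by rw [h, linearForm_single]⟩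
    choose w hw huw using hX
    obtain ⟨w', hw', h⟩ := exists_cross_eq_grad_of_cross_eq_X hu huprim hw huw
    exact hno w' hw' h

end LowDegree

/-! ### Regularity of free and nearly free curves -/

/-- The image of a graded map vanishes below the least degree of a basis vector. -/
theorem IsGradedMap.eq_zero_of_mem_range {m n : ℕ} {a : Fin m → ℤ} {b : Fin n → ℤ}
    {φ : (Fin m → PolyRing) →ₗ[PolyRing] (Fin n → PolyRing)} (hφ : IsGradedMap a b φ) {k : ℤ}
    (hk : ∀ j, k < a j) {x : Fin n → PolyRing} (hx : x ∈ LinearMap.range φ)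
    (hxk : x ∈ freePiece b k) : x = 0 := by
  obtain ⟨w, rfl⟩ := hx
  have h0 : freeComponent a k w = 0 := funext fun j =>
    eq_zero_of_mem_gradedPiece_neg (by linarith [hk j])
      (mem_freePiece.1 (freeComponent_mem a k w) j)
  rw [← freeComponent_of_mem hxk, ← hφ.map_freeComponent, h0, map_zero]

theorem eq_zero_of_isUnit_of_mem_gradedPiece {k : ℤ} {p : PolyRing} (hp : IsUnit p)
    (hk : p ∈ gradedPiece k) : k = 0 := by
  by_contra h
  exact (hp.map constantCoeff).ne_zero (constantCoeff_eq_zero_of_mem_gradedPiece h hk)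

section Regularity

variable {f : PolyRing} {d : ℕ}

/-- If the Jacobian ideal is generated by two coprime forms, `M(f)` is resolved by their Koszul
complex. -/
theorem reg_eq_of_two_generators (hf : f.IsHomogeneous d) (hd : 2 ≤ d) {p q : PolyRing}
    (hp : p ∈ gradedPiece (d - 1 : ℤ)) (hq : q ∈ gradedPiece (d - 1 : ℤ))
    (hpq : IsPrimitiveVector ![p, q])
    (hspan : Submodule.span PolyRing (Set.range ![p, q]) = jacobianIdeal f) :
    reg f = (((2 * (d - 2) : ℤ) : ℝ) : EReal) := by
  have hδ : ∀ v, Fintype.linearCombination PolyRing ![![-q, p]] v = v 0 • ![-q, p] := fun v => by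
    simp [Fintype.linearCombination_apply]
  have hp0 := constantCoeff_eq_zero_of_mem_gradedPiece (by omega) hp
  have hq0 := constantCoeff_eq_zero_of_mem_gradedPiece (by omega) hq
  refine reg_eq_of_resolution hf (by omega) (n₂ := 1) (n₃ := 0) (a₁ := fun _ => (d - 1 : ℤ))
    (a₂ := fun _ => (2 * (d - 1) : ℤ)) (a₃ := Fin.elim0) (g := ![p, q])
    (δ₂ := Fintype.linearCombination PolyRing ![![-q, p]]) (δ₃ := 0) hspan ?_ ?_ ?_
    (fun _ _ _ => zero_mem _) ?_ (fun _ _ => map_zero _) ?_ ?_ (fun _ _ _ => Subsingleton.elim _ _)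
    (by omega) (fun _ => by omega) (fun _ => by omega) (fun j => j.elim0)
    (Or.inl ⟨0, by ring⟩)
  · intro j
    fin_cases j
    · exact hp
    · exact hq
  · intro j
    fin_cases j
    · exact hp0
    · exact hq0
  · refine isGradedMap_of_single fun j => mem_freePiece.2 fun i => ?_
    rw [hδ, show (2 * (d - 1) - (d - 1) : ℤ) = d - 1 by ring, Subsingleton.elim j 0]
    fin_cases i
    · simpa using hq
    · simpa using hp
  · intro v i
    rw [hδ]
    fin_cases i
    · simp [hq0]
    · simp [hp0]
  · intro v
    have h : Fintype.linearCombination PolyRing ![p, q] v = v 0 * p + v 1 * q := by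
      simp [Fintype.linearCombination_apply]
    rw [h]
    constructor
    · intro h
      obtain ⟨t, h0, h1⟩ := hpq.exists_of_mul_add_mul_eq_zero h
      refine ⟨fun _ => t, ?_⟩
      rw [hδ]
      ext1 i
      fin_cases i
      · simp [h0]
      · simp [h1]
    · rintro ⟨w, rfl⟩
      rw [hδ]
      simp
      ring
  · intro v
    rw [hδ, smul_eq_zero]
    constructor
    · intro h
      refine ⟨0, funext fun i => ?_⟩
      rw [Subsingleton.elim i 0, h.resolve_right fun h => hpq.ne_zero ?_]
      · simp
      · have h0 := congrFun h 0
        have h1 := congrFun h 1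
        simp at h0 h1
        simp [h0, h1]
    · rintro ⟨w, rfl⟩
      exact Or.inl rfl

/-- If one partial derivative is a combination of the other two, these are coprime and generate
the Jacobian ideal. -/
theorem reg_eq_of_pderiv_eq (hf : f.IsHomogeneous d) (hd : 2 ≤ d)
    (hprim : IsPrimitiveVector (grad f)) {i j k : Fin 3} (hijk : ∀ l, l = i ∨ l = j ∨ l = k)
    {a b : PolyRing} (h : grad f i = a * grad f j + b * grad f k) :
    reg f = (((2 * (d - 2) : ℤ) : ℝ) : EReal) := by
  refine reg_eq_of_two_generators hf hd (pderiv_mem_gradedPiece hf (by omega) j)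
    (pderiv_mem_gradedPiece hf (by omega) k) (fun p hp => ?_) (le_antisymm ?_ ?_)
  · by_contra! hdvd
    have hj : p ∣ grad f j := hdvd 0
    have hk : p ∣ grad f k := hdvd 1
    obtain ⟨l, hl⟩ := hprim p hp
    rcases hijk l with rfl | rfl | rfl
    · exact hl (h ▸ dvd_add (hj.mul_left a) (hk.mul_left b))
    · exact hl hj
    · exact hl hk
  · refine Submodule.span_mono ?_
    rintro _ ⟨l, rfl⟩
    fin_cases l
    · exact ⟨j, rfl⟩
    · exact ⟨k, rfl⟩
  · refine Submodule.span_le.2 ?_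
    have hj : grad f j ∈ Submodule.span PolyRing (Set.range ![pderiv j f, pderiv k f]) :=
      Submodule.subset_span ⟨0, rfl⟩
    have hk : grad f k ∈ Submodule.span PolyRing (Set.range ![pderiv j f, pderiv k f]) :=
      Submodule.subset_span ⟨1, rfl⟩
    rintro _ ⟨l, rfl⟩
    rcases hijk l with rfl | rfl | rfl
    · change grad f l ∈ _
      rw [h]
      exact add_mem (Submodule.smul_mem _ a hj) (Submodule.smul_mem _ b hk)
    · exact hj
    · exact hk

theorem reg_eq_of_constant_relation (hf : f.IsHomogeneous d) (hd : 2 ≤ d)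
    (hprim : IsPrimitiveVector (grad f)) {u : Fin 3 → PolyRing} (hu : u ∈ AR f) (hu0 : u ≠ 0)
    (hur : ∀ i, u i ∈ gradedPiece 0) : reg f = (((2 * (d - 2) : ℤ) : ℝ) : EReal) := by
  obtain ⟨i, hi⟩ := Function.ne_iff.1 hu0
  obtain ⟨s, hs⟩ : ∃ s, s * u i = 1 := by
    obtain ⟨c, hc⟩ : ∃ c : ℂ, u i = C c := ⟨_, totalDegree_eq_zero_iff_eq_C.1
      ((totalDegree_zero_iff_isHomogeneous _).2 (mem_gradedPiece_natCast.1 (hur i)))⟩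
    have hc0 : c ≠ 0 := by
      rintro rfl
      exact hi (by simpa using hc)
    exact ⟨C c⁻¹, by rw [hc, ← C_mul, inv_mul_cancel₀ hc0, C_1]⟩
  rw [mem_AR_iff, dotProduct, Fin.sum_univ_three] at hu
  fin_cases i
  · exact reg_eq_of_pderiv_eq hf hd hprim (i := 0) (j := 1) (k := 2) (by decide)
      (a := -(s * u 1)) (b := -(s * u 2))
      (by simp only [Fin.zero_eta] at hs; linear_combination s * hu - grad f 0 * hs)
  · exact reg_eq_of_pderiv_eq hf hd hprim (i := 1) (j := 0) (k := 2) (by decide)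
      (a := -(s * u 0)) (b := -(s * u 2))
      (by simp only [Fin.mk_one] at hs; linear_combination s * hu - grad f 1 * hs)
  · exact reg_eq_of_pderiv_eq hf hd hprim (i := 2) (j := 0) (k := 1) (by decide)
      (a := -(s * u 0)) (b := -(s * u 1))
      (by simp only [Fin.reduceFinMk] at hs; linear_combination s * hu - grad f 2 * hs)

/-- For a free curve, with `r` the least degree of a Jacobian relation: the basis of `AR(f)` has
degrees `r` and `d - 1 - r`. -/
theorem reg_eq_of_isFreeCurve (hf : f.IsHomogeneous d) (hd : 4 ≤ d)
    (hprim : IsPrimitiveVector (grad f)) {r : ℕ} {u : Fin 3 → PolyRing}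
    (hu : u ∈ AR f) (hu0 : u ≠ 0) (hur : ∀ i, u i ∈ gradedPiece r)
    (hmin : ∀ v ∈ AR f, v ≠ 0 → ∀ k : ℤ, (∀ i, v i ∈ gradedPiece k) → (r : ℤ) ≤ k)
    (hfree : IsFreeCurve f) :
    2 * r + 1 ≤ d ∧ reg f = (((2 * (d - 2) - r : ℤ) : ℝ) : EReal) := by
  obtain ⟨e₀, e₁, b, hle, h0, h1⟩ : ∃ (e₀ e₁ : ℕ) (b : Module.Basis (Fin 2) PolyRing (AR f)),
      e₀ ≤ e₁ ∧ (∀ i, (b 0 : Fin 3 → PolyRing) i ∈ gradedPiece e₀) ∧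
      ∀ i, (b 1 : Fin 3 → PolyRing) i ∈ gradedPiece e₁ := by
    obtain ⟨e, b, hb⟩ := hfree
    have hb' := fun j i => mem_gradedPiece_natCast.2 (hb j i)
    rcases le_total (e 0) (e 1) with h | h
    · exact ⟨e 0, e 1, b, h, hb' 0, hb' 1⟩
    · exact ⟨e 1, e 0, b.reindex (Equiv.swap 0 1), h, fun i => by simpa using hb' 1 i,
        fun i => by simpa using hb' 0 i⟩
  have hspan : ∀ w ∈ AR f, ∃ a c : PolyRing, w = a • (b 0 : Fin 3 → PolyRing) + c • b 1 := by
    intro w hw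
    refine ⟨b.repr ⟨w, hw⟩ 0, b.repr ⟨w, hw⟩ 1, ?_⟩
    have h := congrArg (AR f).subtype (b.sum_repr ⟨w, hw⟩)
    rw [Fin.sum_univ_two] at h
    exact h.symm
  have hindep : ∀ a c : PolyRing, a • (b 0 : Fin 3 → PolyRing) + c • b 1 = 0 → a = 0 ∧ c = 0 := by
    intro a c h
    have h := Fintype.linearIndependent_iff.1 b.linearIndependent ![a, c]
      (by rw [Fin.sum_univ_two]; exact Subtype.ext h)
    exact ⟨h 0, h 1⟩
  have hb0 : (b 0 : Fin 3 → PolyRing) ∈ AR f := (b 0).2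
  have hb1 : (b 1 : Fin 3 → PolyRing) ∈ AR f := (b 1).2
  generalize (b 0 : Fin 3 → PolyRing) = x at *
  generalize (b 1 : Fin 3 → PolyRing) = y at *
  have hx0 : x ≠ 0 := by
    rintro rfl
    exact one_ne_zero (hindep 1 0 (by simp)).1
  -- By Saito's criterion, the multiplier `h` of `x × y` is a unit; this gives the sum of degrees.
  obtain ⟨h, hxy⟩ := exists_cross_eq_smul_grad hprim hb0 hb1
  have hunit : IsUnit h := isUnit_of_forall_cross hprim fun w hw w' hw' => by
    obtain ⟨a, c, rfl⟩ := hspan w hw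
    obtain ⟨a', c', rfl⟩ := hspan w' hw'
    refine ⟨a * c' - c * a', ?_⟩
    simp only [map_add, map_smul, LinearMap.add_apply, LinearMap.smul_apply, cross_self,
      ← cross_anticomm x y, hxy]
    module
  have hsum : (e₀ + e₁ - (d - 1) : ℤ) = 0 := eq_zero_of_isUnit_of_mem_gradedPiece hunit
    (mem_gradedPiece_of_smul (pderiv_mem_gradedPiece hf (by omega)) hprim.ne_zero
      fun i => hxy ▸ cross_mem_gradedPiece h0 h1 i)
  have hφ : ∀ v, Fintype.linearCombination PolyRing ![x, y] v = v 0 • x + v 1 • y := fun v => by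
    simp [Fintype.linearCombination_apply]
  have hgr : IsGradedMap ![(d - 1 + e₀ : ℤ), (d - 1 + e₁ : ℤ)] (fun _ => (d - 1 : ℤ))
      (Fintype.linearCombination PolyRing ![x, y]) := by
    refine isGradedMap_of_single fun j => mem_freePiece.2 fun i => ?_
    fin_cases j
    · simpa [hφ] using h0 i
    · simpa [hφ] using h1 i
  have hre : (r : ℤ) = e₀ := by
    refine le_antisymm (hmin x hb0 hx0 e₀ h0) ?_
    by_contra! hlt
    refine hu0 (hgr.eq_zero_of_mem_range (k := d - 1 + r) (fun j => ?_) ?_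
      (mem_freePiece.2 fun i => by simpa using hur i))
    · fin_cases j
      · simpa using hlt
      · simp
        omega
    · obtain ⟨a, c, rfl⟩ := hspan u hu
      exact ⟨![a, c], by simp [hφ]⟩
  obtain rfl : r = e₀ := by exact_mod_cast hre
  refine ⟨by omega, ?_⟩
  rcases Nat.eq_zero_or_pos r with rfl | hr
  · simpa using reg_eq_of_constant_relation hf (by omega) hprim hu hu0 hur
  refine reg_eq_of_resolution hf (by omega) (n₂ := 2) (n₃ := 0) (a₁ := fun _ => (d - 1 : ℤ))
    (a₂ := ![(d - 1 + r : ℤ), (d - 1 + e₁ : ℤ)]) (a₃ := Fin.elim0) (g := fun i => pderiv i f)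
    (δ₂ := Fintype.linearCombination PolyRing ![x, y]) (δ₃ := 0) rfl
    (pderiv_mem_gradedPiece hf (by omega))
    (fun i => constantCoeff_eq_zero_of_mem_gradedPiece (by omega)
      (pderiv_mem_gradedPiece hf (by omega) i)) hgr
    (fun _ _ _ => zero_mem _) ?_ (fun _ _ => map_zero _) ?_ ?_ (fun _ _ _ => Subsingleton.elim _ _)
    (by omega) (fun _ => by omega) (fun j => ?_) (fun j => j.elim0)
    (Or.inl ⟨1, by simp; omega⟩)
  · intro v i
    rw [hφ]
    simp [constantCoeff_eq_zero_of_mem_gradedPiece (by omega) (h0 i),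
      constantCoeff_eq_zero_of_mem_gradedPiece (by omega) (h1 i)]
  · intro v
    constructor
    · intro h
      obtain ⟨a, c, rfl⟩ := hspan v h
      exact ⟨![a, c], by simp [hφ]⟩
    · rintro ⟨w, rfl⟩
      rw [hφ]
      exact add_mem (Submodule.smul_mem _ _ hb0) (Submodule.smul_mem _ _ hb1)
  · intro v
    constructor
    · intro h
      rw [hφ] at h
      obtain ⟨h0, h1⟩ := hindep _ _ h
      refine ⟨0, funext fun i => ?_⟩
      fin_cases i
      · exact h0.symm
      · exact h1.symm
    · rintro ⟨w, rfl⟩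
      exact map_zero _
  · fin_cases j
    · simp
      omega
    · simp
      omega

/-- A case of the Hilbert-Burch theorem: if the relations among three generators of `AR(f)` are
generated by a primitive one, its coefficients are, up to a unit, the multipliers of the cross
products of the generators. -/
theorem exists_isUnit_cross_eq (hprim : IsPrimitiveVector (grad f))
    {x y z p : Fin 3 → PolyRing} (hx : x ∈ AR f) (hy : y ∈ AR f) (hz : z ∈ AR f)
    (hspan : ∀ w ∈ AR f, ∃ a b c : PolyRing, w = a • x + b • y + c • z)
    (hp : IsPrimitiveVector p) (hrel : p 0 • x + p 1 • y + p 2 • z = 0) :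
    ∃ t, IsUnit t ∧ z ⨯₃ x = (t * p 1) • grad f ∧ x ⨯₃ y = (t * p 2) • grad f := by
  obtain ⟨g, hg⟩ := exists_cross_eq_smul_grad hprim hy hz
  obtain ⟨h, hh⟩ := exists_cross_eq_smul_grad hprim hz hx
  obtain ⟨k, hk⟩ := exists_cross_eq_smul_grad hprim hx hy
  have hcross : ∀ w, w ⨯₃ (p 0 • x + p 1 • y + p 2 • z) = 0 := fun w => by rw [hrel, map_zero]
  have hpH : p ⨯₃ ![g, h, k] = 0 := by
    have key : ∀ s : PolyRing, s • grad f = 0 → s = 0 := fun s hs =>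
      (smul_eq_zero.1 hs).resolve_right hprim.ne_zero
    have h0 := hcross x
    have h1 := hcross y
    have h2 := hcross z
    simp only [map_add, map_smul, cross_self, smul_zero, hg, hh, hk, ← cross_anticomm x y,
      ← cross_anticomm y z, ← cross_anticomm z x] at h0 h1 h2
    have h0' := key (p 1 * k - p 2 * h) (by rw [← h0]; module)
    have h1' := key (p 2 * g - p 0 * k) (by rw [← h1]; module)
    have h2' := key (p 0 * h - p 1 * g) (by rw [← h2]; module)
    ext1 i
    fin_cases i
    · simpa [cross_apply] using h0'
    · simpa [cross_apply] using h1'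
    · simpa [cross_apply] using h2'
  obtain ⟨t, ht⟩ := hp.exists_eq_smul hpH
  obtain rfl : g = t * p 0 := congrFun ht 0
  obtain rfl : h = t * p 1 := congrFun ht 1
  obtain rfl : k = t * p 2 := congrFun ht 2
  refine ⟨t, isUnit_of_forall_cross hprim fun w hw w' hw' => ?_, hh, hk⟩
  obtain ⟨a, b, c, rfl⟩ := hspan w hw
  obtain ⟨a', b', c', rfl⟩ := hspan w' hw'
  refine ⟨(b * c' - c * b') * p 0 + (c * a' - a * c') * p 1 + (a * b' - b * a') * p 2, ?_⟩
  simp only [map_add, map_smul, LinearMap.add_apply, LinearMap.smul_apply, cross_self, hg, hh, hk,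
    ← cross_anticomm x y, ← cross_anticomm y z, ← cross_anticomm z x]
  module

/-- For a nearly free curve, with `r` the least degree of a Jacobian relation: `d₁ = r` and
`d₁ + d₂ = d`. As in the Hilbert-Burch theorem, the multipliers of the cross products of the three
generators of `AR(f)` are the coefficients of the relation among them, up to a unit. -/
theorem reg_eq_of_isNearlyFreeCurve (hf : f.IsHomogeneous d) (hd : 4 ≤ d)
    (hprim : IsPrimitiveVector (grad f)) {r : ℕ} {u : Fin 3 → PolyRing}
    (hu : u ∈ AR f) (hu0 : u ≠ 0) (hur : ∀ i, u i ∈ gradedPiece r)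
    (hmin : ∀ v ∈ AR f, v ≠ 0 → ∀ k : ℤ, (∀ i, v i ∈ gradedPiece k) → (r : ℤ) ≤ k)
    (hnf : IsNearlyFreeCurve f d) :
    2 * r ≤ d ∧ reg f = (((2 * (d - 2) - r + 1 : ℤ) : ℝ) : EReal) := by
  obtain ⟨d₁, d₂, ψ, φ, hd₁, hd₁₂, hψg, hφg, hψm, hφm, hJm, hψ, hψφ, hφJ⟩ := hnf
  have hψ' : ∀ w, ψ w = w 0 • ψ (Pi.single 0 1) := fun w => by
    conv_lhs => rw [pi_eq_sum_univ' w]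
    simp
  have hφ' : ∀ w, φ w = w 0 • φ (Pi.single 0 1) + w 1 • φ (Pi.single 1 1) +
      w 2 • φ (Pi.single 2 1) := fun w => by
    conv_lhs => rw [pi_eq_sum_univ' w]
    simp [Fin.sum_univ_three]
  have hrel := hφ' (ψ (Pi.single 0 1))
  rw [(hψφ _).2 ⟨_, rfl⟩] at hrel
  have hpdeg := mem_freePiece.1 (hψg _ _ (single_mem_freePiece _ 0))
  have hx0 : φ (Pi.single 0 1) ≠ 0 := by
    intro h
    obtain ⟨w, hw⟩ := (hψφ _).1 h
    simpa [hw] using hψm w 0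
  have hx : ∀ i, φ (Pi.single 0 1) i ∈ gradedPiece d₁ := fun i => by
    have := mem_freePiece.1 (hφg _ _ (single_mem_freePiece _ 0)) i
    fin_cases i <;> simpa using this
  have hy : ∀ i, φ (Pi.single 1 1) i ∈ gradedPiece d₂ := fun i => by
    have := mem_freePiece.1 (hφg _ _ (single_mem_freePiece _ 1)) i
    fin_cases i <;> simpa using this
  have hz : ∀ i, φ (Pi.single 2 1) i ∈ gradedPiece d₂ := fun i => by
    have := mem_freePiece.1 (hφg _ _ (single_mem_freePiece _ 2)) i
    fin_cases i <;> simpa using this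
  have hAR : ∀ w, φ w ∈ AR f := fun w => (hφJ _).2 ⟨w, rfl⟩
  have hpprim : IsPrimitiveVector (ψ (Pi.single 0 1)) := by
    intro q hq
    by_contra! hdvd
    choose p' hp' using hdvd
    have hp : ψ (Pi.single 0 1) = q • p' := funext hp'
    have hker : φ p' = 0 := by
      have h : q • φ p' = 0 := by rw [← map_smul, ← hp, (hψφ _).2 ⟨_, rfl⟩]
      exact (smul_eq_zero.1 h).resolve_left hq.ne_zero
    obtain ⟨w, rfl⟩ := (hψφ _).1 hker
    rw [hψ' w, smul_smul] at hp
    refine hq.not_isUnit (IsUnit.of_mul_eq_one (w 0) ?_)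
    have hp0 : ψ (Pi.single 0 1) ≠ 0 := fun h => by
      have h1 : (Pi.single 0 1 : Fin 1 → PolyRing) = 0 := hψ (h.trans (map_zero ψ).symm)
      simpa using congrFun h1 0
    exact smul_left_injective _ hp0 (hp.symm.trans (one_smul _ _).symm)
  have hspan : ∀ w ∈ AR f, ∃ a b c : PolyRing, w = a • φ (Pi.single 0 1) +
      b • φ (Pi.single 1 1) + c • φ (Pi.single 2 1) := fun w hw => by
    obtain ⟨w', rfl⟩ := (hφJ _).1 hw
    exact ⟨_, _, _, hφ' w'⟩
  obtain ⟨t, ht, hzx, hxy⟩ := exists_isUnit_cross_eq hprim (hAR _) (hAR _) (hAR _) hspan hpprim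
    hrel.symm
  -- One of the two linear coefficients of the relation is nonzero.
  have hsum : d₁ + d₂ = d := by
    have key : ∀ (q : PolyRing) (w w' : Fin 3 → PolyRing) (m n : ℕ), q ≠ 0 → q ∈ gradedPiece 1 →
        (∀ i, w i ∈ gradedPiece m) → (∀ i, w' i ∈ gradedPiece n) →
        w ⨯₃ w' = (t * q) • grad f → m + n = d := by
      intro q w w' m n hq0 hq hw hw' h
      have h1 := mem_gradedPiece_of_smul (pderiv_mem_gradedPiece hf (by omega)) hprim.ne_zero
        fun i => h ▸ cross_mem_gradedPiece hw hw' i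
      have h2 := eq_zero_of_isUnit_of_mem_gradedPiece ht (mem_gradedPiece_of_mul hq hq0 h1)
      omega
    by_cases h1 : ψ (Pi.single 0 1) 1 = 0
    · by_cases h2 : ψ (Pi.single 0 1) 2 = 0
      · rw [h1, h2, zero_smul, zero_smul, add_zero, add_zero, eq_comm, smul_eq_zero] at hrel
        refine absurd (_root_.funext fun i => ?_) hpprim.ne_zero
        fin_cases i
        · exact hrel.resolve_right hx0
        · exact h1
        · exact h2
      · exact key _ _ _ _ _ h2 (by simpa using hpdeg 2) hx hy hxy
    · rw [add_comm]
      exact key _ _ _ _ _ h1 (by simpa using hpdeg 1) hz hx hzx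
  have hre : (r : ℤ) = d₁ := by
    refine le_antisymm (hmin _ (hAR _) hx0 d₁ hx) ?_
    by_contra! hlt
    refine hu0 (hφg.eq_zero_of_mem_range (k := d - 1 + r) (fun j => ?_) ((hφJ _).1 hu)
      (mem_freePiece.2 fun i => ?_))
    · fin_cases j <;> simp <;> omega
    · fin_cases i <;> simpa using hur _
  obtain rfl : r = d₁ := by exact_mod_cast hre
  refine ⟨by omega, ?_⟩
  refine reg_eq_of_resolution hf (by omega) (g := fun i => pderiv i f) rfl (fun i => ?_)
    (fun i => constantCoeff_eq_zero_of_mem_gradedPiece (by omega)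
      (pderiv_mem_gradedPiece hf (by omega) i)) hφg hψg hφm hψm hφJ hψφ hψ
    (by omega) (fun j => ?_) (fun j => ?_) (fun j => ?_) (Or.inr ⟨0, ?_⟩)
  · have := pderiv_mem_gradedPiece hf (by omega) i
    fin_cases i <;> exact this
  · fin_cases j <;> simp <;> omega
  · fin_cases j <;> simp <;> omega
  · fin_cases j
    simp
    omega
  · simp
    omega

/-! ### The least degree of a relation and `mdr_e` -/

theorem le_mdre {r : ℕ}
    (hmin : ∀ v ∈ AR f, v ≠ 0 → ∀ k : ℤ, (∀ i, v i ∈ gradedPiece k) → (r : ℤ) ≤ k) :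
    (r : ℕ∞) ≤ mdre f := by
  refine le_iInf₂ fun s ⟨v, hv, hs, hn⟩ => ?_
  have hv0 : v ≠ 0 := fun h => hn (h ▸ zero_mem _)
  exact_mod_cast hmin v hv hv0 s fun i => mem_gradedPiece_natCast.2 (hs i)

/-- Below degree `d - 1`, every nonzero relation counts for `mdr_e`, since the coefficients of the
Koszul relations are in the Jacobian ideal. -/
theorem mdre_eq (hf : f.IsHomogeneous d) {r : ℕ} (hrd : r + 1 < d) {u : Fin 3 → PolyRing}
    (hu : u ∈ AR f) (hu0 : u ≠ 0) (hur : ∀ i, u i ∈ gradedPiece r)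
    (hmin : ∀ v ∈ AR f, v ≠ 0 → ∀ k : ℤ, (∀ i, v i ∈ gradedPiece k) → (r : ℤ) ≤ k) :
    mdre f = r := by
  refine le_antisymm (iInf₂_le r ⟨u, hu, fun i => mem_gradedPiece_natCast.1 (hur i), fun hk => ?_⟩)
    (le_mdre hmin)
  have hle : koszulRelations f ≤ Submodule.pi Set.univ fun _ => jacobianIdeal f := by
    have hmem : ∀ i, pderiv i f ∈ jacobianIdeal f := fun i => Ideal.subset_span ⟨i, rfl⟩
    refine Submodule.span_le.2 ?_
    rintro _ (rfl | rfl | rfl) i - <;> fin_cases i <;> simp [hmem]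
  refine hu0 (funext fun i => ?_)
  have hi : u i ∈ jacobianIdeal f := hle hk i trivial
  rw [← range_jacobianMap] at hi
  obtain ⟨v, hv⟩ := hi
  have h0 : freeComponent (fun _ => (d - 1 : ℤ)) r v = 0 := funext fun j =>
    eq_zero_of_mem_gradedPiece_neg (by omega)
      (mem_freePiece.1 (freeComponent_mem (fun _ => (d - 1 : ℤ)) r v) j)
  rw [← component_of_mem (hur i), ← hv, ← jacobianMap_freeComponent hf (by omega), h0, map_zero]
  rfl

end Regularity

/-- The trichotomy in the extended reals: the equations for `R` identify the cases `F` and `N`,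
since the values of `R` in the three cases differ. In the third case `A` may be `⊥`, but `R` is not. -/
theorem iff_and_iff_of_cases {A R : EReal} {F N : Prop} (hF : F → ∃ x : ℝ, A = x ∧ R = x)
    (hN : N → ∃ x : ℝ, A = x ∧ R = x + 1)
    (hE : ¬F → ¬N → (∃ x : ℝ, A ≤ x) ∧ (∃ y : ℝ, (y : EReal) ≤ R) ∧ A + 2 ≤ R) :
    (F ↔ R = A) ∧ (N ↔ R = A + 1) ∧ (¬F → ¬N → A + 2 ≤ R) := by
  have hne : ¬F → ¬N → R ≠ A ∧ R ≠ A + 1 := by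
    intro h1 h2
    obtain ⟨⟨x, hx⟩, ⟨y, hy⟩, h⟩ := hE h1 h2
    induction A with
    | bot =>
      have hR : R ≠ ⊥ := fun h0 => (EReal.coe_ne_bot y) (le_bot_iff.1 (h0 ▸ hy))
      simpa using hR
    | top => exact absurd (top_le_iff.1 hx) (EReal.coe_ne_top x)
    | coe a =>
      constructor
      · rintro rfl
        have h' : a + 2 ≤ a := EReal.coe_le_coe_iff.1 h
        linarith
      · rintro rfl
        have h' : a + 2 ≤ a + 1 := EReal.coe_le_coe_iff.1 h
        linarith
  have hxor : F → R ≠ A + 1 := by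
    intro hf h
    obtain ⟨x, rfl, rfl⟩ := hF hf
    have h' : x = x + 1 := by exact_mod_cast h
    linarith
  have hxor' : N → R ≠ A := by
    intro hn h
    obtain ⟨x, rfl, rfl⟩ := hN hn
    have h' : x + 1 = x := by exact_mod_cast h
    linarith
  refine ⟨⟨fun hf => ?_, fun h => ?_⟩, ⟨fun hn => ?_, fun h => ?_⟩, fun h1 h2 => (hE h1 h2).2.2⟩
  · obtain ⟨x, rfl, rfl⟩ := hF hf
    rfl
  · by_contra hf
    by_cases hn : N
    · exact hxor' hn h
    · exact (hne hf hn).1 h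
  · obtain ⟨x, rfl, rfl⟩ := hN hn
    rfl
  · by_contra hn
    by_cases hf : F
    · exact hxor hf h
    · exact (hne hf hn).2 h

end PlaneCurve

theorem corollary3p4 (d : ℕ) (hd : 4 ≤ d) (f : PlaneCurve.PolyRing)
    (hf : f.IsHomogeneous d) (hred : Squarefree f) :
    (PlaneCurve.IsFreeCurve f ↔
      PlaneCurve.reg f = 2 * ((d : EReal) - 2) - ((PlaneCurve.mdre f : ENNReal) : EReal)) ∧
    (PlaneCurve.IsNearlyFreeCurve f d ↔
      PlaneCurve.reg f = 2 * ((d : EReal) - 2) - ((PlaneCurve.mdre f : ENNReal) : EReal) + 1) ∧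
    (¬ PlaneCurve.IsFreeCurve f → ¬ PlaneCurve.IsNearlyFreeCurve f d →
      2 * ((d : EReal) - 2) - ((PlaneCurve.mdre f : ENNReal) : EReal) + 2 ≤ PlaneCurve.reg f) := by
  open PlaneCurve in
  have hprim := isPrimitiveVector_grad hf (by omega) hred
  obtain ⟨r, hrd, ⟨u, hu, hu0, hur⟩, hmin⟩ := exists_minimal_relation hf (by omega) hprim
  have hr : 2 * ((d : EReal) - 2) - (((r : ℕ∞) : ENNReal) : EReal) =
      ((2 * ((d : ℝ) - 2) - r : ℝ) : EReal) := by
    rfl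
  refine iff_and_iff_of_cases (fun h => ?_) (fun h => ?_) fun h1 h2 => ?_
  · obtain ⟨hrd', hreg⟩ := reg_eq_of_isFreeCurve hf hd hprim hu hu0 hur hmin h
    rw [mdre_eq hf (by omega) hu hu0 hur hmin, hr, hreg]
    exact ⟨_, rfl, by push_cast; rfl⟩
  · obtain ⟨hrd', hreg⟩ := reg_eq_of_isNearlyFreeCurve hf hd hprim hu hu0 hur hmin h
    rw [mdre_eq hf (by omega) hu hu0 hur hmin, hr, hreg]
    exact ⟨_, rfl, by push_cast; rfl⟩
  · have hle : 2 * ((d : EReal) - 2) - ((mdre f : ENNReal) : EReal) ≤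
        ((2 * ((d : ℝ) - 2) - r : ℝ) : EReal) := by
      rw [← hr]
      refine EReal.sub_le_sub le_rfl ?_
      exact_mod_cast le_mdre hmin
    have hreg : (((d + (d - r) - 2 : ℤ) : ℝ) : EReal) ≤ reg f := by
      refine le_reg_of_not_generated hf (by omega) (fun v hv i => ?_) fun hgen => ?_
      · have hv0 : freeComponent (fun _ => 0) 0 v = 0 := by
          by_contra h0
          exact h1 (isFreeCurve_of_constant_relation hf (by omega) hprim
            (freeComponent_mem_AR hf (by omega) 0 hv) h0 fun i => by
              simpa using mem_freePiece.1 (freeComponent_mem (fun _ => 0) 0 v) i)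
        have hi := congrFun hv0 i
        simpa [freeComponent, component, MvPolynomial.homogeneousComponent_zero,
          MvPolynomial.constantCoeff_eq] using hi
      · exact (isFreeCurve_or_isNearlyFreeCurve hf (by omega) hprim hrd hu hu0 hur hmin hgen).elim
          h1 h2
    refine ⟨⟨_, hle⟩, ⟨_, hreg⟩, (add_le_add_left hle 2).trans (le_trans (le_of_eq ?_) hreg)⟩
    have h2 : (2 : EReal) = ((2 : ℝ) : EReal) := rfl
    rw [h2, ← EReal.coe_add]
    congr 1
    push_cast
    ring
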